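/- **Theorem 2.** For a geometric potential $E(\gamma,w)$ let $W(x,y)=\frac1{2\pi i}\oint\gamma^{-3}E(\gamma,x+\gamma y)\,d\gamma$ be the associated 2-matrix model potential (contour around $\gamma=0$), and let $\widehat{\mathcal M}$ be the resolved geometry obtained by gluing two copies of $\mathbb C^3$, with coordinates $(\gamma,w_1,w_2)$ and $(\beta,v_1,v_2)$, along $\gamma\neq0$, $\beta\ne 0$ by $$\beta=1/\gamma,\qquad v_1=\gamma^{-1}w_1,\qquad v_2=\gamma^3w_2+\partial_{w_1}E(\gamma,w_1).$$ In the cases below the locus $w_1=w_2=0$, $v_1=v_2=0$ is a $\mathbb P^1\subset\widehat{\mathcal M}$, called the exceptional $\mathbb P^1$. A *global function* on $\widehat{\mathcal M}$ is a function that is a polynomial in $(\gamma,w_1,w_2)$ and also a polynomial in $(\beta,v_1,v_2)$. A hypersurface $\mathcal M_0=\{f=0\}\subset\mathbb C^4$ (coordinates $X,Y,Z,T$) is said to be obtained from $\widehat{\mathcal M}$ by *blowing down the exceptional $\mathbb P^1$* if there is a map $\pi:\widehat{\mathcal M}\to\mathbb C^4$ such that: the four coordinates of $\pi$ are global functions that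 generate the algebra of all global functions, and their ideal of relations is $(f)$; $\pi$ is proper with image $\mathcal M_0$; $\pi^{-1}(0)$ is exactly the exceptional $\mathbb P^1$; and $\pi$ is an isomorphism of algebraic varieties over $\mathcal M_0\setminus\operatorname{Sing}(\mathcal M_0)$. Let $k\ge1$. The potentials $E=\frac{\gamma^2w^{k+1}}{k+1}+\frac{w^2}2$ (type $A_k$), $E=\frac{\gamma^2w^{k+1}}{k+1}+\frac{w^3}3$ (type $D_{k+2}$) and $E=\frac{\gamma^{-1}w^3}3+\frac{\gamma w^4}4$ (type $E_7$) have the following $W$ and $\partial_{w_1}E$, and blowing down the exceptional $\mathbb P^1$ in the corresponding $\widehat{\mathcal M}$ yields the following singular hypersurface $\mathcal M_0$: * $A_k$: $W=\frac1{k+1}x^{k+1}+\frac12y^2$, $\ \partial_{w_1}E=\gamma^2w_1^k+w_1$, $\ \mathcal M_0:\ XY-T(Z^k-T)=0$, whose singular locus is $\{0\}$; * $D_{k+2}$: $W=\frac1{k+1}x^{k+1}+xy^2$, $\ \partial_{w_1}E=\gamma^2w_1^k+w_1^2$, and * for $k$ even, $\mathcal M_0:\ X^2-Y^2Z+T(Z^{k/2}-T)^2=0$,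 whose singular locus is the curve $X=Y=0,\ T=Z^{k/2}$; * for $k$ odd, $\mathcal M_0:\ X^2-Y^2Z-T(Z^k-T^2)=0$, whose singular locus is $\{0\}$; * $E_7$: $W=\frac13y^3+yx^3$, $\ \partial_{w_1}E=\gamma^{-1}w_1^2+\gamma w_1^3$, $\ \mathcal M_0:\ X^2-Y^3+Z^5+3TYZ^2+T^3Z=0$, whose singular locus is the curve $\{(0,-t^5,t^3,t^4): t\in\mathbb C\}$. (In the $A_k$ case and the $D_{k+2}$ case with $k$ odd, $\pi$ is therefore an isomorphism away from the exceptional $\mathbb P^1$.) -/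

import Mathlib

open MvPolynomial

/-! The charts of the resolved geometry are copies of `ℂ³ = Fin 3 → ℂ`, with coordinates
`(γ, w₁, w₂)` and `(β, v₁, v₂)`; singular geometries lie in `ℂ⁴ = Fin 4 → ℂ`, with
coordinates `(X, Y, Z, T)`. -/

namespace Ferrari

/-- The 2-matrix model potential
`W(x, y) = (2πi)⁻¹ ∮ γ⁻³ E(γ, x + γ y) dγ` attached to a geometric potential `E(γ, w)`. -/
noncomputable def superpotential (E : ℂ → ℂ → ℂ) (x y : ℂ) : ℂ :=
  (2 * (Real.pi : ℂ) * Complex.I)⁻¹ *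
    ∮ γ in C(0, 1), γ ^ (-3 : ℤ) * E γ (x + γ * y)

/-- The transition functions `β = 1/γ`, `v₁ = γ⁻¹ w₁`, `v₂ = γ³ w₂ + ∂E/∂w₁ (γ, w₁)`
on `γ ≠ 0`: a point of the `γ`-chart (left) is identified with a point of the `β`-chart (right). -/
inductive Glue (E : ℂ → ℂ → ℂ) : (Fin 3 → ℂ) ⊕ (Fin 3 → ℂ) → (Fin 3 → ℂ) ⊕ (Fin 3 → ℂ) → Prop
  | glue (γ w₁ w₂ : ℂ) (hγ : γ ≠ 0) :
      Glue E (Sum.inl ![γ, w₁, w₂])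
        (Sum.inr ![γ⁻¹, γ⁻¹ * w₁, γ ^ 3 * w₂ + deriv (E γ) w₁])

/-- The resolved geometry: two copies of `ℂ³` glued by the transition functions. -/
def Resolved (E : ℂ → ℂ → ℂ) : Type := Quot (Glue E)

/-- The quotient (gluing) topology. -/
instance (E : ℂ → ℂ → ℂ) : TopologicalSpace (Resolved E) :=
  inferInstanceAs (TopologicalSpace (Quot (Glue E)))

/-- The chart with coordinates `(γ, w₁, w₂)`. -/
def gammaChart (E : ℂ → ℂ → ℂ) (x : Fin 3 → ℂ) : Resolved E := Quot.mk _ (Sum.inl x)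

/-- The chart with coordinates `(β, v₁, v₂)`. -/
def betaChart (E : ℂ → ℂ → ℂ) (x : Fin 3 → ℂ) : Resolved E := Quot.mk _ (Sum.inr x)

/-- The exceptional `ℙ¹`: `w₁ = w₂ = 0` in the `γ`-chart and `v₁ = v₂ = 0` in the `β`-chart. -/
def exceptionalCurve (E : ℂ → ℂ → ℂ) : Set (Resolved E) :=
  Set.range (fun γ : ℂ => gammaChart E ![γ, 0, 0]) ∪
    Set.range (fun β : ℂ => betaChart E ![β, 0, 0])

/-- The algebra of global functions on the resolved geometry: functions which are polynomials
in `(γ, w₁, w₂)` and also polynomials in `(β, v₁, v₂)`. -/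
def globalFunctions (E : ℂ → ℂ → ℂ) : Subalgebra ℂ (Resolved E → ℂ) where
  carrier := {h | (∃ p : MvPolynomial (Fin 3) ℂ, ∀ x, h (gammaChart E x) = eval x p) ∧
    (∃ p : MvPolynomial (Fin 3) ℂ, ∀ x, h (betaChart E x) = eval x p)}
  mul_mem' := by
    rintro a b ⟨⟨p, hp⟩, ⟨q, hq⟩⟩ ⟨⟨p', hp'⟩, ⟨q', hq'⟩⟩
    exact ⟨⟨p * p', fun x => by simp [hp, hp']⟩, ⟨q * q', fun x => by simp [hq, hq']⟩⟩
  add_mem' := by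
    rintro a b ⟨⟨p, hp⟩, ⟨q, hq⟩⟩ ⟨⟨p', hp'⟩, ⟨q', hq'⟩⟩
    exact ⟨⟨p + p', fun x => by simp [hp, hp']⟩, ⟨q + q', fun x => by simp [hq, hq']⟩⟩
  algebraMap_mem' := by
    intro r
    exact ⟨⟨C r, fun x => by simp⟩, ⟨C r, fun x => by simp⟩⟩

/-- The hypersurface `f = 0` in `ℂ⁴`. -/
def hypersurface (f : MvPolynomial (Fin 4) ℂ) : Set (Fin 4 → ℂ) := {q | eval q f = 0}

/-- The points of `f = 0` at which all first partial derivatives of `f` vanish. -/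
def singularLocus (f : MvPolynomial (Fin 4) ℂ) : Set (Fin 4 → ℂ) :=
  {q | eval q f = 0 ∧ ∀ i, eval q (pderiv i f) = 0}

/-- `π` blows down the resolved geometry of `E` to the hypersurface `f = 0`, contracting the
exceptional `ℙ¹` to the origin. -/
structure IsBlowDown (E : ℂ → ℂ → ℂ) (f : MvPolynomial (Fin 4) ℂ)
    (π : Resolved E → (Fin 4 → ℂ)) : Prop where
  /-- The coordinates of `π` are global functions, and they generate all global functions. -/
  generators : (aeval (fun (i : Fin 4) (m : Resolved E) => π m i) :
    MvPolynomial (Fin 4) ℂ →ₐ[ℂ] (Resolved E → ℂ)).range = globalFunctions E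
  /-- The relations among the coordinates of `π` are exactly the multiples of `f`. -/
  relations : RingHom.ker (aeval (fun (i : Fin 4) (m : Resolved E) => π m i) :
    MvPolynomial (Fin 4) ℂ →ₐ[ℂ] (Resolved E → ℂ)) = Ideal.span {f}
  /-- `π` is proper. -/
  proper : IsProperMap π
  /-- `π` maps onto the hypersurface. -/
  range_eq : Set.range π = hypersurface f
  /-- The fibre over the origin is exactly the exceptional `ℙ¹`. -/
  fibre_zero : π ⁻¹' {0} = exceptionalCurve E
  /-- `π` is an isomorphism over the nonsingular part of the hypersurface: near each nonsingular
  point, on a Zariski neighbourhood `d ≠ 0`, a point `m` of the resolved geometry lies in one of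
  the two charts and its coordinates there are the regular functions `nᵢ / d` of `π m`. -/
  iso : ∀ q ∈ hypersurface f \ singularLocus f,
    ∃ chart : (Fin 3 → ℂ) → Resolved E, (chart = gammaChart E ∨ chart = betaChart E) ∧
      ∃ (d : MvPolynomial (Fin 4) ℂ) (n : Fin 3 → MvPolynomial (Fin 4) ℂ), eval q d ≠ 0 ∧
        ∀ m : Resolved E, eval (π m) d ≠ 0 →
          m = chart (fun i => eval (π m) (n i) / eval (π m) d)

/-- `X Y - T (Z ^ k - T)`. -/
noncomputable def polyA (k : ℕ) : MvPolynomial (Fin 4) ℂ :=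
  X 0 * X 1 - X 3 * (X 2 ^ k - X 3)

/-- `X ^ 2 - Y ^ 2 Z + T (Z ^ (k/2) - T) ^ 2`, used for even `k`. -/
noncomputable def polyDEven (k : ℕ) : MvPolynomial (Fin 4) ℂ :=
  X 0 ^ 2 - X 1 ^ 2 * X 2 + X 3 * (X 2 ^ (k / 2) - X 3) ^ 2

/-- `X ^ 2 - Y ^ 2 Z - T (Z ^ k - T ^ 2)`, used for odd `k`. -/
noncomputable def polyDOdd (k : ℕ) : MvPolynomial (Fin 4) ℂ :=
  X 0 ^ 2 - X 1 ^ 2 * X 2 - X 3 * (X 2 ^ k - X 3 ^ 2)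

/-- `X ^ 2 - Y ^ 3 + Z ^ 5 + 3 T Y Z ^ 2 + T ^ 3 Z`. -/
noncomputable def polyE7 : MvPolynomial (Fin 4) ℂ :=
  X 0 ^ 2 - X 1 ^ 3 + X 2 ^ 5 + 3 * X 3 * X 1 * X 2 ^ 2 + X 3 ^ 3 * X 2

/-- Geometric potential of type `A_k`. -/
noncomputable def potentialA (k : ℕ) (γ w : ℂ) : ℂ :=
  γ ^ 2 * w ^ (k + 1) / (k + 1) + w ^ 2 / 2

/-- Geometric potential of type `D_{k+2}`. -/
noncomputable def potentialD (k : ℕ) (γ w : ℂ) : ℂ :=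
  γ ^ 2 * w ^ (k + 1) / (k + 1) + w ^ 3 / 3

/-- Geometric potential of type `E_7`. -/
noncomputable def potentialE7 (γ w : ℂ) : ℂ :=
  γ⁻¹ * w ^ 3 / 3 + γ * w ^ 4 / 4

end Ferrari

/-!
Each blow-down map is given by four explicit polynomials in `(γ, w₁, w₂)`, which agree on the
overlap with four polynomials in `(β, v₁, v₂)`: `gammaA`, `betaA` and their analogues for the other
types. What has to be seen is that they generate all global functions; everything else is a
computation with these polynomials.

In every case the equation `f` is a monic quadratic in one of the four coordinates, with nonzero
discriminant, so `f = 0` is a reduced double cover of `ℂ³` and its coordinate ring `A` is free with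
basis `1, t` over the polynomial ring `R` of `ℂ³`. This gives the ideal of relations
(`dvd_of_vanish`). The charts can be recovered birationally from the image: for suitable coprime
`c, e ∈ R`, the coordinates `γ, w₁, w₂` are regular on `f = 0` away from `c = 0`, and `β, v₁, v₂`
away from `e = 0`. Hence for a global function `h`, both `c ^ N h` and `e ^ N h` lie in `A` for
some `N`. As `c ^ N, e ^ N` are coprime in the factorial ring `R`, they form a regular sequence on
the free module `A`, and `h ∈ A` follows (`exists_mul_of_mul_eq_mul`). This is the normality
argument for `f = 0`, made explicit; it is `isBlowDown_glueMap`.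

The map is proper because `|γ| ≤ 1` or `|β| ≤ 1` at every point, and there the remaining chart
coordinates satisfy monic equations whose coefficients are polynomials in `γ` (or `β`) and the
coordinates of `ℂ⁴` (`mem_boundedOn_of_monic`).

The key identities are the formulas for `γ` as a ratio of functions on `f = 0`:
* type `A`: `γ = (Z ^ k - T) / Y = X / T`;
* type `D`, `k = 2 h`: `γ = (T - Z ^ h) / Y`, with `w₁ = X / Y`;
* type `D`, `k = 2 h + 1`:
  `γ = (Y T - X Z ^ h) / (Y ^ 2 + T Z ^ (2 h)) = (T ^ 2 - Z ^ k) / (Y T + X Z ^ h)`;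
* type `E₇`: `γ = X / (T ^ 2 + Z Y)`.

In each case the common zeros of the numerators and denominators are exactly the singular points.
-/

namespace Ferrari

/-! ### Residues -/

/-- Cauchy's formula for the coefficients of a polynomial. -/
theorem residue_eq_coeff (p : Polynomial ℂ) (n : ℕ) :
    (2 * (Real.pi : ℂ) * Complex.I)⁻¹ *
      (∮ γ in C(0, 1), γ ^ (-(n + 1 : ℤ)) * p.eval γ) = p.coeff n := by
  have hint : ∀ p : Polynomial ℂ,
      CircleIntegrable (fun γ : ℂ => γ ^ (-(n + 1 : ℤ)) * p.eval γ) 0 1 := by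
    intro p
    apply ContinuousOn.circleIntegrable zero_le_one
    intro z hz
    have hz0 : z ≠ 0 := by
      rintro rfl
      simp at hz
    exact ((continuousAt_zpow₀ z _ (Or.inl hz0)).mul p.continuous.continuousAt).continuousWithinAt
  induction p using Polynomial.induction_on' with
  | add p q hp hq =>
    simp only [Polynomial.eval_add, mul_add, Polynomial.coeff_add]
    rw [circleIntegral.integral_add (hint p) (hint q), mul_add, hp, hq]
  | monomial m a =>
    have hcongr : (∮ γ in C(0, 1), γ ^ (-(n + 1 : ℤ)) * (Polynomial.monomial m a).eval γ) =
        a * ∮ γ in C(0, 1), (γ - 0) ^ ((m : ℤ) - n - 1) := by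
      rw [← circleIntegral.integral_const_mul]
      refine circleIntegral.integral_congr zero_le_one fun z hz => ?_
      have hz0 : z ≠ 0 := by
        rintro rfl
        simp at hz
      have : z ^ ((m : ℤ) - n - 1) = z ^ (-(n + 1 : ℤ)) * z ^ m := by
        rw [← zpow_natCast, ← zpow_add₀ hz0]
        congr 1
        ring
      simp only [Polynomial.eval_monomial, sub_zero, this]
      ring
    rw [hcongr, Polynomial.coeff_monomial]
    by_cases hmn : m = n
    · subst hmn
      have : (∮ γ in C(0, 1), (γ - 0) ^ ((m : ℤ) - m - 1)) = 2 * (Real.pi : ℂ) * Complex.I := by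
        rw [← circleIntegral.integral_sub_center_inv 0 one_ne_zero]
        simp
      rw [this, if_pos rfl, mul_comm a, inv_mul_cancel_left₀ Complex.two_pi_I_ne_zero]
    · rw [circleIntegral.integral_sub_zpow_of_ne (by omega), if_neg hmn, mul_zero, mul_zero]

/-- The superpotential of `E` is a Laurent coefficient of `γ ↦ E γ (x + γ y)`. -/
theorem superpotential_eq_coeff {E : ℂ → ℂ → ℂ} {x y : ℂ} (p : Polynomial ℂ) (n : ℕ)
    (h : ∀ γ : ℂ, γ ≠ 0 → E γ (x + γ * y) * γ ^ n = γ ^ 2 * p.eval γ) :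
    superpotential E x y = p.coeff n := by
  rw [← residue_eq_coeff p n, superpotential]
  congr 1
  refine circleIntegral.integral_congr zero_le_one fun z hz => ?_
  have hz0 : z ≠ 0 := by
    rintro rfl
    simp at hz
  have e : z ^ (-(n + 1 : ℤ)) = (z ^ (n + 1))⁻¹ := by
    rw [← zpow_natCast, ← zpow_neg]
    push_cast
    rfl
  have e' : z ^ (-3 : ℤ) = (z ^ 3)⁻¹ := by
    rw [← zpow_natCast, ← zpow_neg]
    rfl
  simp only [e, e']
  rw [inv_mul_eq_div, inv_mul_eq_div, div_eq_div_iff (pow_ne_zero _ hz0) (pow_ne_zero _ hz0)]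
  linear_combination z * h z hz0

/-! ### Double covers of affine space -/

section DoubleCover

variable {σ : Type*} {i : σ} {B D p₀ p₁ : MvPolynomial σ ℂ}

theorem eval_update_of_mem_supported [DecidableEq σ] {p : MvPolynomial σ ℂ}
    (hp : p ∈ supported ℂ ({i}ᶜ : Set σ)) (q : σ → ℂ) (s : ℂ) :
    eval (Function.update q i s) p = eval q p := by
  rw [mem_supported] at hp
  refine eval₂Hom_congr' rfl (fun j hj _ => ?_) rfl
  exact Function.update_of_ne (by simpa using hp hj) _ _

/-- Division by the monic quadratic `X i ^ 2 + B * X i + D`. -/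
theorem exists_linear_remainder (hB : B ∈ supported ℂ ({i}ᶜ : Set σ))
    (hD : D ∈ supported ℂ ({i}ᶜ : Set σ)) (g : MvPolynomial σ ℂ) :
    ∃ p₀ ∈ supported ℂ ({i}ᶜ : Set σ), ∃ p₁ ∈ supported ℂ ({i}ᶜ : Set σ),
      X i ^ 2 + B * X i + D ∣ g - (p₀ + p₁ * X i) := by
  induction g using MvPolynomial.induction_on with
  | C a => exact ⟨C a, Subalgebra.algebraMap_mem _ a, 0, zero_mem _, by simp⟩
  | add g h hg hh =>
    obtain ⟨p₀, hp₀, p₁, hp₁, u, hu⟩ := hg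
    obtain ⟨q₀, hq₀, q₁, hq₁, v, hv⟩ := hh
    exact ⟨p₀ + q₀, add_mem hp₀ hq₀, p₁ + q₁, add_mem hp₁ hq₁, u + v, by linear_combination hu + hv⟩
  | mul_X g j hg =>
    obtain ⟨p₀, hp₀, p₁, hp₁, u, hu⟩ := hg
    by_cases hj : j = i
    · subst hj
      exact ⟨-(p₁ * D), neg_mem (mul_mem hp₁ hD), p₀ - p₁ * B, sub_mem hp₀ (mul_mem hp₁ hB),
        u * X j + p₁, by linear_combination X j * hu⟩
    · have hX : X j ∈ supported ℂ ({i}ᶜ : Set σ) := X_mem_supported.2 (by simpa using hj)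
      exact ⟨p₀ * X j, mul_mem hp₀ hX, p₁ * X j, mul_mem hp₁ hX,
        u * X j, by linear_combination X j * hu⟩

/-- The coordinate ring of a reduced double cover is free on `1` and the square root: both points
of the fibre over `q` are zeros of `p₀ + p₁ t`, so `p₁` vanishes wherever they differ. -/
theorem linear_eq_zero_of_vanish (hB : B ∈ supported ℂ ({i}ᶜ : Set σ))
    (hD : D ∈ supported ℂ ({i}ᶜ : Set σ)) (hdisc : B ^ 2 - 4 * D ≠ 0)
    (hp₀ : p₀ ∈ supported ℂ ({i}ᶜ : Set σ)) (hp₁ : p₁ ∈ supported ℂ ({i}ᶜ : Set σ))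
    (h : ∀ q, eval q (X i ^ 2 + B * X i + D) = 0 → eval q (p₀ + p₁ * X i) = 0) :
    p₀ = 0 ∧ p₁ = 0 := by
  classical
  have key : ∀ q s : _, s ^ 2 = eval q (B ^ 2 - 4 * D) →
      eval q p₀ + eval q p₁ * ((-eval q B + s) / 2) = 0 := by
    intro q s hs
    have := h (Function.update q i ((-eval q B + s) / 2)) (by
      simp only [map_add, map_mul, map_pow, eval_X, Function.update_self,
        eval_update_of_mem_supported hB, eval_update_of_mem_supported hD]
      simp only [map_sub, map_mul, map_pow, map_ofNat] at hs
      linear_combination hs / 4)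
    simpa only [map_add, map_mul, eval_X, Function.update_self,
        eval_update_of_mem_supported hp₀, eval_update_of_mem_supported hp₁] using this
  have h₁ : p₁ = 0 := by
    have : p₁ * (B ^ 2 - 4 * D) = 0 := by
      refine MvPolynomial.funext fun q => ?_
      obtain ⟨s, hs⟩ := IsAlgClosed.exists_pow_nat_eq (eval q (B ^ 2 - 4 * D)) two_pos
      have h₁ := key q s hs
      have h₂ := key q (-s) (by rw [neg_sq, hs])
      rw [map_mul, ← hs, map_zero]
      linear_combination s * (h₁ - h₂)
    exact (mul_eq_zero.1 this).resolve_right hdisc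
  refine ⟨MvPolynomial.funext fun q => ?_, h₁⟩
  obtain ⟨s, hs⟩ := IsAlgClosed.exists_pow_nat_eq (eval q (B ^ 2 - 4 * D)) two_pos
  simpa [h₁] using key q s hs

/-- The vanishing ideal of a reduced double cover `X i ^ 2 + B * X i + D = 0` is generated by its
equation. -/
theorem dvd_of_vanish (hB : B ∈ supported ℂ ({i}ᶜ : Set σ))
    (hD : D ∈ supported ℂ ({i}ᶜ : Set σ)) (hdisc : B ^ 2 - 4 * D ≠ 0) {g : MvPolynomial σ ℂ}
    (h : ∀ q, eval q (X i ^ 2 + B * X i + D) = 0 → eval q g = 0) :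
    X i ^ 2 + B * X i + D ∣ g := by
  obtain ⟨p₀, hp₀, p₁, hp₁, hdvd⟩ := exists_linear_remainder hB hD g
  obtain ⟨rfl, rfl⟩ := linear_eq_zero_of_vanish hB hD hdisc hp₀ hp₁ (fun q hq => by
    obtain ⟨u, hu⟩ := hdvd
    have := congrArg (eval q) hu
    rw [map_sub, map_mul, hq, h q hq, zero_mul, zero_sub, neg_eq_zero] at this
    exact this)
  simpa using hdvd

/-- If `e, c` is a pair of coprime functions on the base of a reduced double cover `V`, then
`e g = c g'` on `V` forces `g` to be a multiple of `c` on `V`. -/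
theorem exists_mul_of_mul_eq_mul (hB : B ∈ supported ℂ ({i}ᶜ : Set σ))
    (hD : D ∈ supported ℂ ({i}ᶜ : Set σ)) (hdisc : B ^ 2 - 4 * D ≠ 0)
    {c e g g' : MvPolynomial σ ℂ} (hc : c ∈ supported ℂ ({i}ᶜ : Set σ))
    (he : e ∈ supported ℂ ({i}ᶜ : Set σ)) (hce : IsRelPrime c e)
    (h : ∀ q, eval q (X i ^ 2 + B * X i + D) = 0 → eval q (e * g) = eval q (c * g')) :
    ∃ u, ∀ q, eval q (X i ^ 2 + B * X i + D) = 0 → eval q g = eval q (c * u) := by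
  obtain ⟨p₀, hp₀, p₁, hp₁, u, hu⟩ := exists_linear_remainder hB hD g
  obtain ⟨q₀, hq₀, q₁, hq₁, v, hv⟩ := exists_linear_remainder hB hD g'
  obtain ⟨h₀, h₁⟩ := linear_eq_zero_of_vanish hB hD hdisc
    (sub_mem (mul_mem he hp₀) (mul_mem hc hq₀)) (sub_mem (mul_mem he hp₁) (mul_mem hc hq₁))
    (fun q hq => by
      have e₁ := congrArg (eval q) hu
      have e₂ := congrArg (eval q) hv
      have e₃ := h q hq
      rw [map_mul, hq, zero_mul] at e₁ e₂
      simp only [map_add, map_sub, map_mul] at e₁ e₂ e₃ ⊢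
      linear_combination e₃ - eval q e * e₁ + eval q c * e₂)
  obtain ⟨u₀, hu₀⟩ := hce.dvd_of_dvd_mul_left (Dvd.intro q₀ (sub_eq_zero.1 h₀).symm)
  obtain ⟨u₁, hu₁⟩ := hce.dvd_of_dvd_mul_left (Dvd.intro q₁ (sub_eq_zero.1 h₁).symm)
  refine ⟨u₀ + u₁ * X i, fun q hq => ?_⟩
  have e₁ := congrArg (eval q) hu
  rw [map_mul, hq, zero_mul, hu₀, hu₁] at e₁
  simp only [map_add, map_sub, map_mul] at e₁ ⊢
  linear_combination e₁

theorem degreeOf_eq_zero_iff_notMem_vars {p : MvPolynomial σ ℂ} :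
    degreeOf i p = 0 ↔ i ∉ p.vars := by
  classical
  rw [degreeOf_def, vars_def, Multiset.mem_toFinset, Multiset.count_eq_zero]

/-- A common divisor of `a` and of a polynomial not involving `X i` does not involve `X i` either,
hence divides the derivative of `a` as well. -/
theorem dvd_pderiv_of_dvd {g r a : MvPolynomial σ ℂ} (hr0 : r ≠ 0)
    (hr : r ∈ supported ℂ ({i}ᶜ : Set σ)) (hgr : g ∣ r) (hga : g ∣ a) : g ∣ pderiv i a := by
  obtain ⟨s, rfl⟩ := hgr
  obtain ⟨b, rfl⟩ := hga
  have hg0 : g ≠ 0 := left_ne_zero_of_mul hr0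
  have hs0 : s ≠ 0 := right_ne_zero_of_mul hr0
  have hvars : i ∉ g.vars := by
    rw [mem_supported] at hr
    have h := (degreeOf_eq_zero_iff_notMem_vars (i := i)).2 fun hi => by simpa using hr hi
    rw [degreeOf_mul_eq hg0 hs0] at h
    exact degreeOf_eq_zero_iff_notMem_vars.1 (by omega)
  rw [Derivation.leibniz, pderiv_eq_zero_of_notMem_vars hvars, smul_zero, add_zero, smul_eq_mul]
  exact dvd_mul_right _ _

end DoubleCover

/-! ### Algebras of functions -/

/-- The functions on `ℂ⁴` which on the open set `d ≠ 0` are of the form `n / d ^ N`; their values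
on `d = 0` are arbitrary. -/
def regularAway (d : MvPolynomial (Fin 4) ℂ) : Subalgebra ℂ ((Fin 4 → ℂ) → ℂ) where
  carrier := {φ | ∃ (n : MvPolynomial (Fin 4) ℂ) (N : ℕ), ∀ q, eval q d ≠ 0 →
    φ q = eval q n / eval q d ^ N}
  mul_mem' := by
    rintro φ ψ ⟨n, N, h⟩ ⟨m, M, h'⟩
    refine ⟨n * m, N + M, fun q hq => ?_⟩
    rw [Pi.mul_apply, h q hq, h' q hq, map_mul, pow_add, div_mul_div_comm]
  add_mem' := by
    rintro φ ψ ⟨n, N, h⟩ ⟨m, M, h'⟩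
    refine ⟨n * d ^ M + d ^ N * m, N + M, fun q hq => ?_⟩
    rw [Pi.add_apply, h q hq, h' q hq, pow_add,
      div_add_div _ _ (pow_ne_zero _ hq) (pow_ne_zero _ hq)]
    simp
  algebraMap_mem' r := ⟨C r, 0, fun q _ => by simp⟩

theorem eval_mem_regularAway (d n : MvPolynomial (Fin 4) ℂ) :
    (fun q => eval q n) ∈ regularAway d := ⟨n, 0, fun q _ => by simp⟩

theorem coord_mem_regularAway (d : MvPolynomial (Fin 4) ℂ) (i : Fin 4) :
    (fun q => q i) ∈ regularAway d := by simpa using eval_mem_regularAway d (X i)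

theorem div_mem_regularAway (d n : MvPolynomial (Fin 4) ℂ) :
    (fun q => eval q n / eval q d) ∈ regularAway d := ⟨n, 1, fun q _ => by simp⟩

theorem eval_comp_mem {S σ : Type*} (A : Subalgebra ℂ (S → ℂ)) {φ : σ → S → ℂ}
    (hφ : ∀ i, φ i ∈ A) (p : MvPolynomial σ ℂ) : (fun s => eval (fun i => φ i s) p) ∈ A := by
  induction p using MvPolynomial.induction_on with
  | C a => simpa only [eval_C] using! A.algebraMap_mem a
  | add p q hp hq => simpa using! add_mem hp hq
  | mul_X p i hp => simpa using! mul_mem hp (hφ i)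

/-- The complex functions on `α` that are bounded on `S`. -/
def boundedOn {α : Type*} (S : Set α) : Subalgebra ℂ (α → ℂ) where
  carrier := {φ | ∃ c : ℝ, ∀ x ∈ S, ‖φ x‖ ≤ c}
  mul_mem' := by
    rintro φ ψ ⟨c, h⟩ ⟨c', h'⟩
    exact ⟨c * c', fun x hx => by
      rw [Pi.mul_apply, norm_mul]
      exact mul_le_mul (h x hx) (h' x hx) (norm_nonneg _) ((norm_nonneg _).trans (h x hx))⟩
  add_mem' := by
    rintro φ ψ ⟨c, h⟩ ⟨c', h'⟩
    exact ⟨c + c', fun x hx => (norm_add_le _ _).trans (add_le_add (h x hx) (h' x hx))⟩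
  algebraMap_mem' r := ⟨‖r‖, fun x _ => le_rfl⟩

/-- The algebra of bounded functions is integrally closed: a function satisfying a monic equation
with bounded coefficients is bounded. -/
theorem mem_boundedOn_of_monic {α : Type*} {S : Set α} {φ : α → ℂ} {n : ℕ} {a : ℕ → α → ℂ}
    (ha : ∀ j, a j ∈ boundedOn S)
    (h : ∀ x, φ x ^ (n + 1) = ∑ j ∈ Finset.range (n + 1), a j x * φ x ^ j) :
    φ ∈ boundedOn S := by
  choose c hc using ha
  refine ⟨max 1 (∑ j ∈ Finset.range (n + 1), c j), fun x hx => ?_⟩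
  rcases le_or_gt ‖φ x‖ 1 with h1 | h1
  · exact h1.trans (le_max_left _ _)
  · refine le_trans ?_ (le_max_right _ _)
    have hpos : 0 < ‖φ x‖ ^ n := pow_pos (one_pos.trans h1) n
    refine le_of_mul_le_mul_right ?_ hpos
    calc ‖φ x‖ * ‖φ x‖ ^ n = ‖φ x ^ (n + 1)‖ := by rw [norm_pow, pow_succ']
      _ = ‖∑ j ∈ Finset.range (n + 1), a j x * φ x ^ j‖ := by rw [h]
      _ ≤ ∑ j ∈ Finset.range (n + 1), c j * ‖φ x‖ ^ n := by
        refine norm_sum_le_of_le _ fun j hj => ?_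
        rw [norm_mul, norm_pow]
        exact mul_le_mul (hc j x hx)
          (pow_le_pow_right₀ h1.le (Nat.lt_succ_iff.1 (Finset.mem_range.1 hj)))
          (by positivity) ((norm_nonneg _).trans (hc j x hx))
      _ = (∑ j ∈ Finset.range (n + 1), c j) * ‖φ x‖ ^ n := by rw [Finset.sum_mul]

theorem mem_boundedOn_of_sq {α : Type*} {S : Set α} {φ a : α → ℂ} (ha : a ∈ boundedOn S)
    (h : ∀ x, φ x ^ 2 = a x) : φ ∈ boundedOn S := by
  refine mem_boundedOn_of_monic (n := 1) (a := fun j => if j = 0 then a else 0)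
    (fun j => ?_) (fun x => ?_)
  · split_ifs
    exacts [ha, zero_mem _]
  · simp [Finset.sum_range_succ, h]

/-- The quotient `(a ^ k - b ^ k) / (a - b)` as a polynomial in `a` and `b`. -/
def geomQuot {R : Type*} [CommRing R] (k : ℕ) (a b : R) : R :=
  ∑ j ∈ Finset.range k, a ^ j * b ^ (k - 1 - j)

theorem geomQuot_mul {R : Type*} [CommRing R] (k : ℕ) (a b : R) :
    geomQuot k a b * (a - b) = a ^ k - b ^ k := geom_sum₂_mul a b k

@[simp]
theorem map_geomQuot {R R' : Type*} [CommRing R] [CommRing R'] (f : R →+* R') (k : ℕ) (a b : R) :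
    f (geomQuot k a b) = geomQuot k (f a) (f b) := by
  simp [geomQuot]

theorem geomQuot_mem {α : Type*} {A : Subalgebra ℂ (α → ℂ)} {a b : α → ℂ} (ha : a ∈ A)
    (hb : b ∈ A) (k : ℕ) : (fun x => geomQuot k (a x) (b x)) ∈ A := by
  have : (fun x => geomQuot k (a x) (b x)) =
      ∑ j ∈ Finset.range k, a ^ j * b ^ (k - 1 - j) := by
    funext x
    simp [geomQuot]
  rw [this]
  exact sum_mem fun j _ => mul_mem (pow_mem ha _) (pow_mem hb _)

/-! ### Maps out of the resolved geometry -/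

section Glue

variable {E : ℂ → ℂ → ℂ} {P Q : Fin 4 → MvPolynomial (Fin 3) ℂ}

/-- The polynomial maps `P` on the `γ`-chart and `Q` on the `β`-chart agree on the overlap. -/
def Compatible (E : ℂ → ℂ → ℂ) (P Q : Fin 4 → MvPolynomial (Fin 3) ℂ) : Prop :=
  ∀ γ w₁ w₂ : ℂ, γ ≠ 0 → ∀ i, eval ![γ, w₁, w₂] (P i) =
    eval ![γ⁻¹, γ⁻¹ * w₁, γ ^ 3 * w₂ + deriv (E γ) w₁] (Q i)

/-- The map `Resolved E → ℂ⁴` given by `P` on the `γ`-chart and by `Q` on the `β`-chart. -/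
noncomputable def glueMap (h : Compatible E P Q) : Resolved E → (Fin 4 → ℂ) :=
  Quot.lift (Sum.elim (fun x i => eval x (P i)) (fun x i => eval x (Q i))) (by
    rintro _ _ ⟨γ, w₁, w₂, hγ⟩
    exact _root_.funext fun i => h γ w₁ w₂ hγ i)

variable (h : Compatible E P Q)

theorem glueMap_gammaChart (x : Fin 3 → ℂ) :
    glueMap h (gammaChart E x) = fun i => eval x (P i) := rfl

theorem glueMap_betaChart (x : Fin 3 → ℂ) :
    glueMap h (betaChart E x) = fun i => eval x (Q i) := rfl

theorem eval_glueMap_gammaChart (x : Fin 3 → ℂ) (g : MvPolynomial (Fin 4) ℂ) :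
    eval (glueMap h (gammaChart E x)) g = eval x (bind₁ P g) := by
  rw [glueMap_gammaChart, ← aeval_eq_eval, ← aeval_eq_eval, aeval_bind₁]

theorem eval_glueMap_betaChart (x : Fin 3 → ℂ) (g : MvPolynomial (Fin 4) ℂ) :
    eval (glueMap h (betaChart E x)) g = eval x (bind₁ Q g) := by
  rw [glueMap_betaChart, ← aeval_eq_eval, ← aeval_eq_eval, aeval_bind₁]

theorem exists_chart (m : Resolved E) :
    (∃ x, m = gammaChart E x) ∨ ∃ x, m = betaChart E x := by
  induction m using Quot.ind with
  | mk a =>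
    rcases a with x | x
    exacts [Or.inl ⟨x, rfl⟩, Or.inr ⟨x, rfl⟩]

theorem gammaChart_eq_betaChart {x : Fin 3 → ℂ} (hx : x 0 ≠ 0) :
    ∃ y, gammaChart E x = betaChart E y ∧ y 0 = (x 0)⁻¹ := by
  refine ⟨_, Eq.trans ?_ (Quot.sound (Glue.glue (x 0) (x 1) (x 2) hx)), rfl⟩
  rw [gammaChart]
  congr 2
  ext i
  fin_cases i <;> rfl

theorem betaChart_eq_gammaChart {x : Fin 3 → ℂ} (hx : x 0 ≠ 0) :
    ∃ y, betaChart E x = gammaChart E y ∧ y 0 = (x 0)⁻¹ := by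
  have hx' := inv_ne_zero hx
  refine ⟨_, Eq.trans ?_ (Quot.sound (Glue.glue (x 0)⁻¹ ((x 0)⁻¹ * x 1)
    ((x 0) ^ 3 * (x 2 - deriv (E (x 0)⁻¹) ((x 0)⁻¹ * x 1))) hx')).symm, rfl⟩
  rw [betaChart]
  congr 2
  ext i
  fin_cases i
  · simp
  · simp [hx]
  · simp only [Fin.isValue, Fin.reduceFinMk, Matrix.cons_val]
    field_simp
    ring

/-- Every point has `|γ| ≤ 1` or `|β| ≤ 1`. -/
theorem exists_chart_norm_le (m : Resolved E) :
    (∃ x, ‖x 0‖ ≤ 1 ∧ m = gammaChart E x) ∨ ∃ x, ‖x 0‖ ≤ 1 ∧ m = betaChart E x := by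
  have hinv : ∀ z : ℂ, 1 < ‖z‖ → z ≠ 0 ∧ ‖z⁻¹‖ ≤ 1 := fun z hz =>
    ⟨norm_pos_iff.1 (one_pos.trans hz), by rw [norm_inv]; exact inv_le_one_of_one_le₀ hz.le⟩
  rcases exists_chart m with ⟨x, rfl⟩ | ⟨x, rfl⟩
  · rcases le_or_gt ‖x 0‖ 1 with hx | hx
    · exact Or.inl ⟨x, hx, rfl⟩
    · obtain ⟨y, hy, hy0⟩ := gammaChart_eq_betaChart (E := E) (hinv _ hx).1
      exact Or.inr ⟨y, hy0 ▸ (hinv _ hx).2, hy⟩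
  · rcases le_or_gt ‖x 0‖ 1 with hx | hx
    · exact Or.inr ⟨x, hx, rfl⟩
    · obtain ⟨y, hy, hy0⟩ := betaChart_eq_gammaChart (E := E) (hinv _ hx).1
      exact Or.inl ⟨y, hy0 ▸ (hinv _ hx).2, hy⟩

theorem continuous_gammaChart : Continuous (gammaChart E) :=
  continuous_quot_mk.comp continuous_inl

theorem continuous_betaChart : Continuous (betaChart E) :=
  continuous_quot_mk.comp continuous_inr

theorem continuous_glueMap : Continuous (glueMap h) := by
  refine continuous_quot_lift _ (Continuous.sumElim ?_ ?_) <;>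
  exact continuous_pi fun i => MvPolynomial.continuous_eval _

/-- On a chart map `R`, the coordinates are bounded on every set on which `R` and the coordinate
along the `ℙ¹` are bounded. -/
def BoundsCoordinates (R : Fin 4 → MvPolynomial (Fin 3) ℂ) : Prop :=
  ∀ S : Set (Fin 3 → ℂ), (fun x => x 0) ∈ boundedOn S →
    (∀ i, (fun x => eval x (R i)) ∈ boundedOn S) →
      (fun x => x 1) ∈ boundedOn S ∧ (fun x => x 2) ∈ boundedOn S

theorem BoundsCoordinates.isBounded {R : Fin 4 → MvPolynomial (Fin 3) ℂ}
    (hR : BoundsCoordinates R) {K : Set (Fin 4 → ℂ)} (hK : IsCompact K) :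
    Bornology.IsBounded {x : Fin 3 → ℂ | ‖x 0‖ ≤ 1 ∧ (fun i => eval x (R i)) ∈ K} := by
  obtain ⟨c, hc⟩ := hK.isBounded.exists_norm_le
  have h0 : (fun x : Fin 3 → ℂ => x 0) ∈
      boundedOn {x : Fin 3 → ℂ | ‖x 0‖ ≤ 1 ∧ (fun i => eval x (R i)) ∈ K} :=
    ⟨1, fun x hx => hx.1⟩
  obtain ⟨⟨c₁, h₁⟩, ⟨c₂, h₂⟩⟩ := hR _ h0 (fun i => ⟨c, fun x hx =>
    (norm_le_pi_norm (fun i => eval x (R i)) i).trans (hc _ hx.2)⟩)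
  refine (isBounded_iff_forall_norm_le).2 ⟨max 1 (max c₁ c₂), fun x hx => ?_⟩
  refine (pi_norm_le_iff_of_nonneg (zero_le_one.trans (le_max_left _ _))).2 fun i => ?_
  fin_cases i
  · exact hx.1.trans (le_max_left _ _)
  · exact (h₁ x hx).trans ((le_max_left _ _).trans (le_max_right _ _))
  · exact (h₂ x hx).trans ((le_max_right _ _).trans (le_max_right _ _))

theorem isProperMap_glueMap (hP : BoundsCoordinates P) (hQ : BoundsCoordinates Q) :
    IsProperMap (glueMap h) := by
  refine isProperMap_iff_isCompact_preimage.2 ⟨continuous_glueMap h, fun K hK => ?_⟩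
  have hc := ((hP.isBounded hK).isCompact_closure.image (continuous_gammaChart (E := E))).union
    ((hQ.isBounded hK).isCompact_closure.image (continuous_betaChart (E := E)))
  refine hc.of_isClosed_subset (hK.isClosed.preimage (continuous_glueMap h)) fun m hm => ?_
  rcases exists_chart_norm_le m with ⟨x, hx, rfl⟩ | ⟨x, hx, rfl⟩
  · exact Or.inl ⟨x, subset_closure ⟨hx, hm⟩, rfl⟩
  · exact Or.inr ⟨x, subset_closure ⟨hx, hm⟩, rfl⟩

/-- Over `d ≠ 0`, every point lies in the given chart, with coordinates that are regular functions
of its image under `π`. -/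
def InvertibleAway (π : Resolved E → (Fin 4 → ℂ)) (chart : (Fin 3 → ℂ) → Resolved E)
    (d : MvPolynomial (Fin 4) ℂ) : Prop :=
  ∃ φ : Fin 3 → ((Fin 4 → ℂ) → ℂ), (∀ i, φ i ∈ regularAway d) ∧
    ∀ m, eval (π m) d ≠ 0 → m = chart (fun i => φ i (π m))

/-- To invert over `d ≠ 0` in the `γ`-chart, it suffices to invert `P` there and to check that `d`
vanishes on the fibre `β = 0`. -/
theorem invertibleAway_gammaChart {d : MvPolynomial (Fin 4) ℂ} (φ : Fin 3 → ((Fin 4 → ℂ) → ℂ))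
    (hφ : ∀ i, φ i ∈ regularAway d)
    (hP : ∀ x, eval (fun i => eval x (P i)) d ≠ 0 → ∀ j, x j = φ j (fun i => eval x (P i)))
    (hQ : ∀ x, x 0 = 0 → eval (fun i => eval x (Q i)) d = 0) :
    InvertibleAway (glueMap h) (gammaChart E) d := by
  have key : ∀ x, eval (glueMap h (gammaChart E x)) d ≠ 0 →
      gammaChart E x = gammaChart E (fun i => φ i (glueMap h (gammaChart E x))) :=
    fun x hx => congrArg _ (_root_.funext (hP x hx))
  refine ⟨φ, hφ, fun m hm => ?_⟩
  rcases exists_chart m with ⟨x, rfl⟩ | ⟨x, rfl⟩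
  · exact key x hm
  · obtain ⟨y, hy, -⟩ := betaChart_eq_gammaChart (E := E) (mt (hQ x) hm)
    rw [hy] at hm ⊢
    exact key y hm

theorem invertibleAway_betaChart {d : MvPolynomial (Fin 4) ℂ} (φ : Fin 3 → ((Fin 4 → ℂ) → ℂ))
    (hφ : ∀ i, φ i ∈ regularAway d)
    (hQ : ∀ x, eval (fun i => eval x (Q i)) d ≠ 0 → ∀ j, x j = φ j (fun i => eval x (Q i)))
    (hP : ∀ x, x 0 = 0 → eval (fun i => eval x (P i)) d = 0) :
    InvertibleAway (glueMap h) (betaChart E) d := by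
  have key : ∀ x, eval (glueMap h (betaChart E x)) d ≠ 0 →
      betaChart E x = betaChart E (fun i => φ i (glueMap h (betaChart E x))) :=
    fun x hx => congrArg _ (_root_.funext (hQ x hx))
  refine ⟨φ, hφ, fun m hm => ?_⟩
  rcases exists_chart m with ⟨x, rfl⟩ | ⟨x, rfl⟩
  · obtain ⟨y, hy, -⟩ := gammaChart_eq_betaChart (E := E) (mt (hP x) hm)
    rw [hy] at hm ⊢
    exact key y hm
  · exact key x hm

/-- Inverting `d` is the same as inverting a polynomial that restricts to `d ^ 2`. -/
theorem InvertibleAway.of_eq_sq {π : Resolved E → (Fin 4 → ℂ)}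
    {chart : (Fin 3 → ℂ) → Resolved E} {d d' : MvPolynomial (Fin 4) ℂ}
    (hd : InvertibleAway π chart d) (h : ∀ m, eval (π m) d' = eval (π m) d ^ 2) :
    InvertibleAway π chart d' := by
  obtain ⟨φ, hφ, hm⟩ := hd
  choose n N hn using hφ
  refine ⟨fun i q => eval q (n i * d ^ N i) / eval q d' ^ N i, fun i => ⟨_, _, fun q _ => rfl⟩,
    fun m hm' => ?_⟩
  have h0 : eval (π m) d ≠ 0 := fun h0 => hm' (by rw [h, h0, zero_pow two_ne_zero])
  refine (hm m h0).trans (congrArg _ (_root_.funext fun i => ?_))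
  simp only [hn i _ h0, h, map_mul, map_pow]
  field_simp
  ring

theorem InvertibleAway.exists_div {π : Resolved E → (Fin 4 → ℂ)}
    {chart : (Fin 3 → ℂ) → Resolved E} {d : MvPolynomial (Fin 4) ℂ}
    (hd : InvertibleAway π chart d) {q : Fin 4 → ℂ} (hq : eval q d ≠ 0) :
    ∃ (d' : MvPolynomial (Fin 4) ℂ) (n : Fin 3 → MvPolynomial (Fin 4) ℂ), eval q d' ≠ 0 ∧
      ∀ m : Resolved E, eval (π m) d' ≠ 0 →
        m = chart (fun i => eval (π m) (n i) / eval (π m) d') := by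
  obtain ⟨φ, hφ, hm⟩ := hd
  choose n N hn using hφ
  refine ⟨d ^ (∑ i, N i + 1), fun i => n i * d ^ (∑ i, N i + 1 - N i), ?_, fun m h => ?_⟩
  · rw [map_pow]
    exact pow_ne_zero _ hq
  · rw [map_pow] at h
    have h0 : eval (π m) d ≠ 0 := fun h0 => h (by rw [h0, zero_pow (Nat.succ_ne_zero _)])
    rw [hm m h0]
    congr 1
    funext i
    rw [← hm m h0, hn i _ h0, map_mul, map_pow, map_pow, div_eq_div_iff (pow_ne_zero _ h0) h,
      mul_assoc, ← pow_add]
    congr 2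
    have := Finset.single_le_sum (f := N) (fun _ _ => Nat.zero_le _) (Finset.mem_univ i)
    omega

/-- A global function becomes a polynomial in the coordinates of `π` after multiplication by a
power of `d`. -/
theorem InvertibleAway.exists_pow_mul {π : Resolved E → (Fin 4 → ℂ)}
    {chart : (Fin 3 → ℂ) → Resolved E} {d : MvPolynomial (Fin 4) ℂ}
    (hd : InvertibleAway π chart d) {f : Resolved E → ℂ} {p : MvPolynomial (Fin 3) ℂ}
    (hp : ∀ x, f (chart x) = eval x p) :
    ∃ (g : MvPolynomial (Fin 4) ℂ) (N : ℕ), ∀ M, N < M → ∀ m,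
      eval (π m) d ^ M * f m = eval (π m) (d ^ (M - N) * g) := by
  obtain ⟨φ, hφ, hm⟩ := hd
  obtain ⟨g, N, hg⟩ := eval_comp_mem _ hφ p
  refine ⟨g, N, fun M hM m => ?_⟩
  rw [map_mul, map_pow]
  by_cases h0 : eval (π m) d = 0
  · rw [h0, zero_pow (by omega), zero_pow (by omega), zero_mul, zero_mul]
  · have e : f m = eval (π m) g / eval (π m) d ^ N := by
      rw [← hg _ h0]
      exact (congrArg f (hm m h0)).trans (hp _)
    rw [e, ← Nat.sub_add_cancel hM.le, pow_add, Nat.add_sub_cancel]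
    field_simp

/-- The criterion for blowing down. The equation of the hypersurface is a monic quadratic in one of
the coordinates, with nonzero discriminant. The charts are inverted birationally over `c ≠ 0` and
`e ≠ 0`, where `c` and `e` are coprime functions of the other three coordinates; since they form a
regular sequence on the hypersurface, a global function, which is regular where `c ≠ 0` and where
`e ≠ 0`, is a polynomial in the coordinates of `ℂ⁴`. -/
theorem isBlowDown_glueMap {f : MvPolynomial (Fin 4) ℂ} {i : Fin 4}
    {B D c e : MvPolynomial (Fin 4) ℂ} (hf : f = X i ^ 2 + B * X i + D)
    (hB : B ∈ supported ℂ ({i}ᶜ : Set (Fin 4))) (hD : D ∈ supported ℂ ({i}ᶜ : Set (Fin 4)))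
    (hdisc : B ^ 2 - 4 * D ≠ 0)
    (hfP : ∀ x, eval (fun i => eval x (P i)) f = 0)
    (hfQ : ∀ x, eval (fun i => eval x (Q i)) f = 0)
    (hsurj : ∀ q, eval q f = 0 →
      (∃ x, ∀ i, eval x (P i) = q i) ∨ ∃ x, ∀ i, eval x (Q i) = q i)
    (hbP : BoundsCoordinates P) (hbQ : BoundsCoordinates Q)
    (h0P : ∀ x, (∀ i, eval x (P i) = 0) ↔ x 1 = 0 ∧ x 2 = 0)
    (h0Q : ∀ x, (∀ i, eval x (Q i) = 0) ↔ x 1 = 0 ∧ x 2 = 0)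
    (hc : c ∈ supported ℂ ({i}ᶜ : Set (Fin 4))) (he : e ∈ supported ℂ ({i}ᶜ : Set (Fin 4)))
    (hce : IsRelPrime c e)
    (hcP : ∃ x, eval (fun i => eval x (P i)) c ≠ 0)
    (hcQ : ∃ x, eval (fun i => eval x (Q i)) c ≠ 0)
    (hic : InvertibleAway (glueMap h) (gammaChart E) c)
    (hie : InvertibleAway (glueMap h) (betaChart E) e)
    (hiso : ∀ q ∈ hypersurface f \ singularLocus f, ∃ d, eval q d ≠ 0 ∧
      (InvertibleAway (glueMap h) (gammaChart E) d ∨ InvertibleAway (glueMap h) (betaChart E) d)) :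
    IsBlowDown E f (glueMap h) := by
  have hrange : Set.range (glueMap h) = hypersurface f := by
    ext q
    constructor
    · rintro ⟨m, rfl⟩
      rcases exists_chart m with ⟨x, rfl⟩ | ⟨x, rfl⟩
      exacts [hfP x, hfQ x]
    · intro hq
      rcases hsurj q hq with ⟨x, hx⟩ | ⟨x, hx⟩
      exacts [⟨gammaChart E x, _root_.funext hx⟩, ⟨betaChart E x, _root_.funext hx⟩]
  have hmem : ∀ m, eval (glueMap h m) f = 0 := fun m => by
    have : glueMap h m ∈ hypersurface f := hrange ▸ Set.mem_range_self m
    exact this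
  have haeval : ∀ g : MvPolynomial (Fin 4) ℂ,
      aeval (fun (i : Fin 4) (m : Resolved E) => glueMap h m i) g =
        fun m => eval (glueMap h m) g := by
    intro g
    funext m
    induction g using MvPolynomial.induction_on with
    | C a => simp
    | add p q hp hq => simp [hp, hq]
    | mul_X p i hp => simp [hp]
  refine ⟨?_, ?_, isProperMap_glueMap h hbP hbQ, hrange, ?_, ?_⟩
  · ext φ
    simp only [AlgHom.mem_range, haeval]
    constructor
    · rintro ⟨g, rfl⟩
      exact ⟨⟨_, fun x => eval_glueMap_gammaChart h x g⟩,
        ⟨_, fun x => eval_glueMap_betaChart h x g⟩⟩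
    · rintro ⟨⟨p, hp⟩, ⟨p', hp'⟩⟩
      obtain ⟨g, N, hg⟩ := hic.exists_pow_mul hp
      obtain ⟨g', N', hg'⟩ := hie.exists_pow_mul hp'
      have hg := hg (N + N' + 1) (by omega)
      have hg' := hg' (N + N' + 1) (by omega)
      obtain ⟨u, hu⟩ := exists_mul_of_mul_eq_mul hB hD hdisc (pow_mem hc (N + N' + 1))
        (pow_mem he (N + N' + 1)) hce.pow (g := c ^ (N + N' + 1 - N) * g)
        (g' := e ^ (N + N' + 1 - N') * g') (fun q hq => by
          rw [← hf] at hq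
          obtain ⟨m, rfl⟩ : q ∈ Set.range (glueMap h) := hrange ▸ hq
          rw [map_mul, map_mul _ (c ^ (N + N' + 1)), ← hg m, ← hg' m, map_pow, map_pow]
          ring)
      rw [← hf] at hu
      have key : ∀ m, eval (glueMap h m) c ^ (N + N' + 1) *
          (φ m - eval (glueMap h m) u) = 0 := fun m => by
        rw [mul_sub, hg m, hu _ (hmem m), map_mul, map_pow, sub_self]
      -- polynomial identities on a chart may be checked where `c ≠ 0`
      have hchart : ∀ (R : Fin 4 → MvPolynomial (Fin 3) ℂ) (p : MvPolynomial (Fin 3) ℂ),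
          (∃ x, eval (fun i => eval x (R i)) c ≠ 0) →
          (∀ x, eval x (bind₁ R c) = eval (fun i => eval x (R i)) c) →
          (∀ x, eval x (bind₁ R c) ^ (N + N' + 1) * (eval x p - eval x (bind₁ R u)) = 0) →
          p = bind₁ R u := by
        rintro R p ⟨x, hx⟩ hRc hR
        have h0 : bind₁ R c ^ (N + N' + 1) * (p - bind₁ R u) = 0 :=
          MvPolynomial.funext fun x => by simpa using hR x
        rcases mul_eq_zero.1 h0 with h1 | h1
        · rw [← hRc, pow_eq_zero_iff (Nat.succ_ne_zero _) |>.1 h1, map_zero] at hx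
          exact absurd rfl hx
        · exact sub_eq_zero.1 h1
      refine ⟨u, _root_.funext fun m => ?_⟩
      rcases exists_chart m with ⟨x, rfl⟩ | ⟨x, rfl⟩
      · rw [hp, eval_glueMap_gammaChart]
        rw [hchart P p hcP (fun x => (eval_glueMap_gammaChart h x c).symm) fun x => by
          simpa only [hp, eval_glueMap_gammaChart] using key (gammaChart E x)]
      · rw [hp', eval_glueMap_betaChart]
        rw [hchart Q p' hcQ (fun x => (eval_glueMap_betaChart h x c).symm) fun x => by
          simpa only [hp', eval_glueMap_betaChart] using key (betaChart E x)]
  · ext g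
    rw [RingHom.mem_ker, Ideal.mem_span_singleton, haeval]
    constructor
    · intro hg
      rw [hf]
      refine dvd_of_vanish hB hD hdisc fun q hq => ?_
      rw [← hf] at hq
      obtain ⟨m, rfl⟩ : q ∈ Set.range (glueMap h) := hrange ▸ hq
      exact congrFun hg m
    · rintro ⟨u, rfl⟩
      funext m
      rw [map_mul, hmem, zero_mul, Pi.zero_apply]
  · have hform : ∀ x : Fin 3 → ℂ, x 1 = 0 ∧ x 2 = 0 → x = ![x 0, 0, 0] := by
      rintro x ⟨h1, h2⟩
      funext i
      fin_cases i
      exacts [rfl, h1, h2]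
    ext m
    rw [Set.mem_preimage, Set.mem_singleton_iff]
    constructor
    · intro hm
      rcases exists_chart m with ⟨x, rfl⟩ | ⟨x, rfl⟩
      · exact Or.inl ⟨x 0, (congrArg _ (hform x ((h0P x).1 (congrFun hm)))).symm⟩
      · exact Or.inr ⟨x 0, (congrArg _ (hform x ((h0Q x).1 (congrFun hm)))).symm⟩
    · rintro (⟨t, rfl⟩ | ⟨t, rfl⟩)
      · exact _root_.funext ((h0P _).2 ⟨rfl, rfl⟩)
      · exact _root_.funext ((h0Q _).2 ⟨rfl, rfl⟩)
  · intro q hq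
    obtain ⟨d, hd, hinv | hinv⟩ := hiso q hq
    · exact ⟨_, Or.inl rfl, hinv.exists_div hd⟩
    · exact ⟨_, Or.inr rfl, hinv.exists_div hd⟩

end Glue

/-! ### Type `A` -/

section TypeA

theorem superpotential_A (k : ℕ) (x y : ℂ) :
    superpotential (potentialA k) x y = 1 / (k + 1) * x ^ (k + 1) + 1 / 2 * y ^ 2 := by
  rw [superpotential_eq_coeff (Polynomial.C (1 / (k + 1) : ℂ) *
        (Polynomial.C x + Polynomial.C y * Polynomial.X) ^ (k + 1) * Polynomial.X ^ 2
      + (Polynomial.C (x ^ 2 / 2) + Polynomial.C (x * y) * Polynomial.X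
      + Polynomial.C (1 / 2 * y ^ 2) * Polynomial.X ^ 2)) 2 fun γ hγ => ?_]
  · rw [Polynomial.coeff_add]
    congr 1
    · rw [show 2 = 0 + 2 from rfl, Polynomial.coeff_mul_X_pow, Polynomial.coeff_zero_eq_eval_zero]
      simp
    · simp only [Polynomial.coeff_add, Polynomial.coeff_C_mul, Polynomial.coeff_C,
        Polynomial.coeff_X, Polynomial.coeff_X_pow]
      norm_num
  · simp only [potentialA, Polynomial.eval_add, Polynomial.eval_mul, Polynomial.eval_C,
      Polynomial.eval_pow, Polynomial.eval_X]
    ring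

theorem hasDerivAt_A (k : ℕ) (γ w : ℂ) :
    HasDerivAt (potentialA k γ) (γ ^ 2 * w ^ k + w) w := by
  have h := (((hasDerivAt_pow (k + 1) w).const_mul (γ ^ 2)).div_const (k + 1 : ℂ)).add
    ((hasDerivAt_pow 2 w).div_const 2)
  convert! h using 1
  have hk : (k + 1 : ℂ) ≠ 0 := Nat.cast_add_one_ne_zero k
  simp only [Nat.cast_add, Nat.cast_one, Nat.add_sub_cancel]
  field_simp
  push_cast
  ring

/-- The blow-down map of type `A` on the `γ`-chart. In terms of the `β`-chart, `Z = v₂`,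
`X = β Z - v₁` and `T = β X`, which are visibly polynomial in `γ, w₁, w₂`; the function
`Y = β (Z ^ k - T)` is so as well, since `Z ≡ w₁` modulo `γ X`. -/
noncomputable def gammaA (k : ℕ) : Fin 4 → MvPolynomial (Fin 3) ℂ :=
  let T := X 0 * X 2 + X 1 ^ k
  let Z := X 0 ^ 2 * T + X 1
  ![X 0 * T, X 0 * T * geomQuot k Z (X 1) - X 2, Z, T]

/-- The blow-down map of type `A` on the `β`-chart. -/
noncomputable def betaA (k : ℕ) : Fin 4 → MvPolynomial (Fin 3) ℂ :=
  let T := X 0 * (X 0 * X 2 - X 1)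
  ![X 0 * X 2 - X 1, X 0 * (X 2 ^ k - T), X 2, T]

variable {k : ℕ}

theorem eval_gammaA (x : Fin 3 → ℂ) : (fun i => eval x (gammaA k i)) =
    let T := x 0 * x 2 + x 1 ^ k
    let Z := x 0 ^ 2 * T + x 1
    ![x 0 * T, x 0 * T * geomQuot k Z (x 1) - x 2, Z, T] := by
  funext i
  fin_cases i <;> simp [gammaA]

theorem eval_betaA (x : Fin 3 → ℂ) : (fun i => eval x (betaA k i)) =
    let T := x 0 * (x 0 * x 2 - x 1)
    ![x 0 * x 2 - x 1, x 0 * (x 2 ^ k - T), x 2, T] := by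
  funext i
  fin_cases i <;> simp [betaA]

theorem eval_polyA (q : Fin 4 → ℂ) :
    eval q (polyA k) = q 0 * q 1 - q 3 * (q 2 ^ k - q 3) := by
  simp [polyA]

/-- `γ Y = Z ^ k - T` on the `γ`-chart. -/
theorem gammaA_mul (g w u : ℂ) :
    g * (g * (g * u + w ^ k) * geomQuot k (g ^ 2 * (g * u + w ^ k) + w) w - u) =
      (g ^ 2 * (g * u + w ^ k) + w) ^ k - (g * u + w ^ k) := by
  linear_combination geomQuot_mul k (g ^ 2 * (g * u + w ^ k) + w) w

theorem compatible_A : Compatible (potentialA k) (gammaA k) (betaA k) := by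
  intro γ w₁ w₂ hγ i
  revert i
  rw [← funext_iff, eval_gammaA, eval_betaA, (hasDerivAt_A k γ w₁).deriv]
  have hZ : γ ^ 3 * w₂ + (γ ^ 2 * w₁ ^ k + w₁) = γ ^ 2 * (γ * w₂ + w₁ ^ k) + w₁ := by ring
  have hX : γ⁻¹ * (γ ^ 2 * (γ * w₂ + w₁ ^ k) + w₁) - γ⁻¹ * w₁ = γ * (γ * w₂ + w₁ ^ k) := by
    field_simp
    ring
  funext i
  fin_cases i
  · simp [hZ, hX]
  · simp only [Fin.mk_one, Matrix.cons_val, hZ, hX, inv_mul_cancel_left₀ hγ, ← gammaA_mul]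
  · simp [hZ]
  · simp [hZ, hX, hγ]

theorem singularLocus_A (hk : 1 ≤ k) : singularLocus (polyA k) = {0} := by
  have hd0 : ∀ q, eval q (pderiv 0 (polyA k)) = q 1 := fun q => by
    simp [polyA, pderiv_X]
  have hd1 : ∀ q, eval q (pderiv 1 (polyA k)) = q 0 := fun q => by
    simp [polyA, pderiv_X]
  have hd2 : ∀ q, eval q (pderiv 2 (polyA k)) = -(q 3 * (k * q 2 ^ (k - 1))) := fun q => by
    simp [polyA, pderiv_X]
  have hd3 : ∀ q, eval q (pderiv 3 (polyA k)) = 2 * q 3 - q 2 ^ k := fun q => by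
    simp [polyA, pderiv_X]
    ring
  ext q
  rw [Set.mem_singleton_iff]
  constructor
  · rintro ⟨-, hq⟩
    have h0 := hq 0
    have h1 := hq 1
    have h2 := hq 2
    have h3 := hq 3
    rw [hd0] at h0
    rw [hd1] at h1
    rw [hd2] at h2
    rw [hd3] at h3
    have hk0 : (k : ℂ) ≠ 0 := Nat.cast_ne_zero.2 (by omega)
    have hZ : q 2 = 0 := by
      by_contra hZ
      have hT : q 3 = 0 := by simpa [hk0, hZ] using h2
      rw [hT, mul_zero, zero_sub, neg_eq_zero] at h3
      exact hZ (pow_eq_zero_iff (by omega) |>.1 h3)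
    have hT : q 3 = 0 := by
      rw [hZ, zero_pow (by omega)] at h3
      simpa using h3
    funext i
    fin_cases i
    exacts [h1, h0, hZ, hT]
  · rintro rfl
    have hk0 : k ≠ 0 := by omega
    refine ⟨(eval_polyA 0).trans (by simp), fun i => ?_⟩
    fin_cases i
    · exact hd0 0
    · exact hd1 0
    · exact (hd2 0).trans (by simp)
    · exact (hd3 0).trans (by simp [hk0])

theorem eval_polyA_gammaA (x : Fin 3 → ℂ) :
    eval (fun i => eval x (gammaA k i)) (polyA k) = 0 := by
  rw [eval_gammaA, eval_polyA]
  simp only [Matrix.cons_val]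
  linear_combination (x 0 * x 2 + x 1 ^ k) * gammaA_mul (k := k) (x 0) (x 1) (x 2)

theorem eval_polyA_betaA (x : Fin 3 → ℂ) :
    eval (fun i => eval x (betaA k i)) (polyA k) = 0 := by
  rw [eval_betaA, eval_polyA]
  simp only [Matrix.cons_val]
  ring

/-- A point of the hypersurface has a preimage in the `γ`-chart as soon as one can solve
`γ Y = Z ^ k - T` and `γ T = X`; if `Y = T = 0`, there is one with `β = 0`. -/
theorem exists_preimage_A {q : Fin 4 → ℂ} (hq : eval q (polyA k) = 0) :
    (∃ x, ∀ i, eval x (gammaA k i) = q i) ∨ ∃ x, ∀ i, eval x (betaA k i) = q i := by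
  simp_rw [← funext_iff, eval_gammaA, eval_betaA]
  rw [eval_polyA] at hq
  have key : ∀ g, g * q 1 = q 2 ^ k - q 3 → g * q 3 = q 0 →
      ∃ x : Fin 3 → ℂ, ![x 0 * (x 0 * x 2 + x 1 ^ k),
        x 0 * (x 0 * x 2 + x 1 ^ k) *
          geomQuot k (x 0 ^ 2 * (x 0 * x 2 + x 1 ^ k) + x 1) (x 1) - x 2,
        x 0 ^ 2 * (x 0 * x 2 + x 1 ^ k) + x 1, x 0 * x 2 + x 1 ^ k] = q := by
    intro g hY hX
    set w := q 2 - g * q 0 with hw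
    set u := q 0 * geomQuot k (q 2) w - q 1 with hu
    have hT : g * u + w ^ k = q 3 := by
      linear_combination geomQuot_mul k (q 2) w - hY
    have hZ : g ^ 2 * q 3 + w = q 2 := by
      linear_combination g * hX
    refine ⟨![g, w, u], ?_⟩
    funext i
    fin_cases i
    · simp only [Fin.zero_eta, Matrix.cons_val, hT, hX]
    · simp only [Fin.mk_one, Matrix.cons_val, hT, hZ, hX]
      ring
    · simp only [Fin.reduceFinMk, Matrix.cons_val, hT, hZ]
    · simp only [Fin.reduceFinMk, Matrix.cons_val, hT]
  by_cases hY : q 1 = 0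
  · by_cases hT : q 3 = 0
    · refine Or.inr ⟨![0, -q 0, q 2], ?_⟩
      funext i
      fin_cases i <;> simp [hY, hT]
    · refine Or.inl (key (q 0 / q 3) ?_ (div_mul_cancel₀ _ hT))
      field_simp
      linear_combination hq
  · refine Or.inl (key ((q 2 ^ k - q 3) / q 1) (div_mul_cancel₀ _ hY) ?_)
    field_simp
    linear_combination -hq

theorem boundsCoordinates_gammaA : BoundsCoordinates (gammaA k) := by
  intro S h0 hR
  have hX : (fun x : Fin 3 → ℂ => x 0 * (x 0 * x 2 + x 1 ^ k)) ∈ boundedOn S := by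
    simpa [gammaA] using hR 0
  have hY : (fun x : Fin 3 → ℂ => x 0 * (x 0 * x 2 + x 1 ^ k) *
      geomQuot k (x 0 ^ 2 * (x 0 * x 2 + x 1 ^ k) + x 1) (x 1) - x 2) ∈ boundedOn S := by
    simpa [gammaA] using hR 1
  have hZ : (fun x : Fin 3 → ℂ => x 0 ^ 2 * (x 0 * x 2 + x 1 ^ k) + x 1) ∈ boundedOn S := by
    simpa [gammaA] using hR 2
  have h1 : (fun x : Fin 3 → ℂ => x 1) ∈ boundedOn S := by
    convert! sub_mem hZ (mul_mem h0 hX) using 1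
    funext x
    simp only [Pi.sub_apply, Pi.mul_apply]
    ring
  refine ⟨h1, ?_⟩
  convert! sub_mem (mul_mem hX (geomQuot_mem hZ h1 k)) hY using 1
  funext x
  simp

theorem boundsCoordinates_betaA : BoundsCoordinates (betaA k) := by
  intro S h0 hR
  have hX : (fun x : Fin 3 → ℂ => x 0 * x 2 - x 1) ∈ boundedOn S := by
    simpa [betaA] using hR 0
  have h2 : (fun x : Fin 3 → ℂ => x 2) ∈ boundedOn S := by
    simpa [betaA] using hR 2
  refine ⟨?_, h2⟩
  convert! sub_mem (mul_mem h0 h2) hX using 1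
  funext x
  simp

theorem gammaA_eq_zero_iff (hk : 1 ≤ k) (x : Fin 3 → ℂ) :
    (∀ i, eval x (gammaA k i) = 0) ↔ x 1 = 0 ∧ x 2 = 0 := by
  have hk0 : k ≠ 0 := by omega
  constructor
  · intro h
    have hT : x 0 * x 2 + x 1 ^ k = 0 := by simpa [gammaA] using h 3
    exact ⟨by simpa [gammaA, hT] using h 2, by simpa [gammaA, hT] using h 1⟩
  · rintro ⟨h1, h2⟩ i
    fin_cases i <;> simp [gammaA, h1, h2, hk0]

theorem betaA_eq_zero_iff (hk : 1 ≤ k) (x : Fin 3 → ℂ) :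
    (∀ i, eval x (betaA k i) = 0) ↔ x 1 = 0 ∧ x 2 = 0 := by
  have hk0 : k ≠ 0 := by omega
  constructor
  · intro h
    have h2 : x 2 = 0 := by simpa [betaA] using h 2
    exact ⟨by simpa [betaA, h2] using h 0, h2⟩
  · rintro ⟨h1, h2⟩ i
    fin_cases i <;> simp [betaA, h1, h2, hk0]

/-- The `γ`-chart is inverted wherever `γ` can be written as a fraction `n / d`. -/
theorem invertibleAway_gammaA {n d : MvPolynomial (Fin 4) ℂ}
    (hP : ∀ x, x 0 * eval (fun i => eval x (gammaA k i)) d = eval (fun i => eval x (gammaA k i)) n)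
    (hQ : ∀ x, x 0 = 0 → eval (fun i => eval x (betaA k i)) d = 0) :
    InvertibleAway (glueMap (compatible_A (k := k))) (gammaChart (potentialA k)) d := by
  have hγ := div_mem_regularAway d n
  have hX := coord_mem_regularAway d 0
  have hZ := coord_mem_regularAway d 2
  have hw := sub_mem hZ (mul_mem hγ hX)
  refine invertibleAway_gammaChart _
    ![fun q => eval q n / eval q d, fun q => q 2 - eval q n / eval q d * q 0,
      fun q => q 0 * geomQuot k (q 2) (q 2 - eval q n / eval q d * q 0) - q 1] ?_ ?_ hQ
  · intro j
    fin_cases j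
    · exact hγ
    · exact hw
    · exact sub_mem (mul_mem hX (geomQuot_mem hZ hw k)) (coord_mem_regularAway d 1)
  · intro x hx
    have h0 : x 0 = eval (fun i => eval x (gammaA k i)) n /
        eval (fun i => eval x (gammaA k i)) d := (eq_div_iff hx).2 (hP x)
    have h1 : x 1 = eval x (gammaA k 2) - x 0 * eval x (gammaA k 0) := by
      simp [gammaA]
      ring
    intro j
    fin_cases j
    · exact h0
    · change x 1 = _ - _ / _ * _
      rw [← h0, ← h1]
    · change x 2 = _ * geomQuot k _ (_ - _ / _ * _) - _
      rw [← h0, ← h1]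
      simp [gammaA]

/-- The `β`-chart is inverted wherever `β` can be written as a fraction `n / d`. -/
theorem invertibleAway_betaA {n d : MvPolynomial (Fin 4) ℂ}
    (hQ : ∀ x, x 0 * eval (fun i => eval x (betaA k i)) d = eval (fun i => eval x (betaA k i)) n)
    (hP : ∀ x, x 0 = 0 → eval (fun i => eval x (gammaA k i)) d = 0) :
    InvertibleAway (glueMap (compatible_A (k := k))) (betaChart (potentialA k)) d := by
  have hβ := div_mem_regularAway d n
  have hX := coord_mem_regularAway d 0
  have hZ := coord_mem_regularAway d 2
  refine invertibleAway_betaChart _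
    ![fun q => eval q n / eval q d, fun q => eval q n / eval q d * q 2 - q 0, fun q => q 2]
    ?_ ?_ hP
  · intro j
    fin_cases j
    exacts [hβ, sub_mem (mul_mem hβ hZ) hX, hZ]
  · intro x hx
    have h0 : x 0 = eval (fun i => eval x (betaA k i)) n /
        eval (fun i => eval x (betaA k i)) d := (eq_div_iff hx).2 (hQ x)
    intro j
    fin_cases j
    · exact h0
    · change x 1 = _ / _ * _ - _
      rw [← h0]
      simp [betaA]
    · simp [betaA]

theorem invertibleAway_gammaA_Y :
    InvertibleAway (glueMap (compatible_A (k := k))) (gammaChart (potentialA k)) (X 1) := by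
  refine invertibleAway_gammaA (n := X 2 ^ k - X 3) (fun x => ?_) (fun x hx => ?_)
  · rw [eval_gammaA]
    simpa using gammaA_mul (k := k) (x 0) (x 1) (x 2)
  · simp [betaA, hx]

theorem invertibleAway_betaA_X :
    InvertibleAway (glueMap (compatible_A (k := k))) (betaChart (potentialA k)) (X 0) := by
  refine invertibleAway_betaA (n := X 3) (fun x => ?_) (fun x hx => ?_)
  · simp [betaA]
  · simp [gammaA, hx]

theorem isBlowDown_A (hk : 1 ≤ k) :
    IsBlowDown (potentialA k) (polyA k) (glueMap compatible_A) := by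
  have hk0 : k ≠ 0 := by omega
  refine isBlowDown_glueMap compatible_A (i := 3) (B := -X 2 ^ k) (D := X 0 * X 1)
    (c := X 1) (e := X 0) ?_ (neg_mem (pow_mem (X_mem_supported.2 (by decide)) k))
    (mul_mem (X_mem_supported.2 (by decide)) (X_mem_supported.2 (by decide))) ?_
    eval_polyA_gammaA eval_polyA_betaA (fun q => exists_preimage_A)
    boundsCoordinates_gammaA boundsCoordinates_betaA (gammaA_eq_zero_iff hk) (betaA_eq_zero_iff hk)
    (X_mem_supported.2 (by decide)) (X_mem_supported.2 (by decide)) ?_ ?_ ?_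
    invertibleAway_gammaA_Y invertibleAway_betaA_X ?_
  · rw [polyA]
    ring
  · intro h
    have := congrArg (eval ![1, 1, 0, 0]) h
    simp [hk0] at this
  · intro g hg hg'
    have := dvd_pderiv_of_dvd (i := 1) (X_ne_zero 0) (X_mem_supported.2 (by decide)) hg' hg
    rw [pderiv_X_self] at this
    exact isUnit_of_dvd_one this
  · exact ⟨![0, 0, 1], by simp [gammaA]⟩
  · exact ⟨![1, 1, 0], by simp [betaA, hk0]⟩
  · rintro q ⟨hq, hq'⟩
    rw [singularLocus_A hk, Set.mem_singleton_iff] at hq'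
    by_cases hX : q 0 = 0
    · by_cases hY : q 1 = 0
      · by_cases hT : q 3 = 0
        · refine ⟨X 3 - X 2 ^ k, fun hd => hq' ?_, Or.inr (invertibleAway_betaA (n := -X 1)
            (fun x => ?_) (fun x hx => ?_))⟩
          · have hZ : q 2 = 0 := by simpa [hT, hk0] using hd
            funext i
            fin_cases i
            exacts [hX, hY, hZ, hT]
          · simp [betaA]
            ring
          · simp [gammaA, hx]
        · refine ⟨X 3, by simpa using hT, Or.inl (invertibleAway_gammaA (n := X 0)
            (fun x => ?_) (fun x hx => ?_))⟩
          · simp [gammaA]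
          · simp [betaA, hx]
      · exact ⟨X 1, by simpa using hY, Or.inl invertibleAway_gammaA_Y⟩
    · exact ⟨X 0, by simpa using hX, Or.inr invertibleAway_betaA_X⟩

end TypeA

/-! ### Type `D` -/

section TypeD

theorem superpotential_D (k : ℕ) (x y : ℂ) :
    superpotential (potentialD k) x y = 1 / (k + 1) * x ^ (k + 1) + x * y ^ 2 := by
  rw [superpotential_eq_coeff (Polynomial.C (1 / (k + 1) : ℂ) *
        (Polynomial.C x + Polynomial.C y * Polynomial.X) ^ (k + 1) * Polynomial.X ^ 2
      + (Polynomial.C (x ^ 3 / 3) + Polynomial.C (x ^ 2 * y) * Polynomial.X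
      + Polynomial.C (x * y ^ 2) * Polynomial.X ^ 2
      + Polynomial.C (y ^ 3 / 3) * Polynomial.X ^ 3)) 2 fun γ hγ => ?_]
  · rw [Polynomial.coeff_add]
    congr 1
    · rw [show 2 = 0 + 2 from rfl, Polynomial.coeff_mul_X_pow, Polynomial.coeff_zero_eq_eval_zero]
      simp
    · simp only [Polynomial.coeff_add, Polynomial.coeff_C_mul, Polynomial.coeff_C,
        Polynomial.coeff_X, Polynomial.coeff_X_pow]
      norm_num
  · simp only [potentialD, Polynomial.eval_add, Polynomial.eval_mul, Polynomial.eval_C,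
      Polynomial.eval_pow, Polynomial.eval_X]
    ring

theorem hasDerivAt_D (k : ℕ) (γ w : ℂ) :
    HasDerivAt (potentialD k γ) (γ ^ 2 * w ^ k + w ^ 2) w := by
  have h := (((hasDerivAt_pow (k + 1) w).const_mul (γ ^ 2)).div_const (k + 1 : ℂ)).add
    ((hasDerivAt_pow 3 w).div_const 3)
  convert! h using 1
  have hk : (k + 1 : ℂ) ≠ 0 := Nat.cast_add_one_ne_zero k
  simp only [Nat.cast_add, Nat.cast_one, Nat.add_sub_cancel]
  field_simp
  push_cast
  ring

end TypeD

/-! ### Type `D`, even case -/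

section TypeDEven

/-- The blow-down map of type `D` for `k = 2 h`, on the `γ`-chart. In terms of the `β`-chart,
`Z = v₂`, `T = β ^ 2 Z - v₁ ^ 2`, `Y = β (T - Z ^ h)` and `X = v₁ (T - Z ^ h)`; the last two are
polynomial in `γ, w₁, w₂` since `T ≡ w₁ ^ (2 h)` and `Z ≡ w₁ ^ 2` modulo `γ`. -/
noncomputable def gammaDEven (h : ℕ) : Fin 4 → MvPolynomial (Fin 3) ℂ :=
  let T := X 0 * X 2 + X 1 ^ (2 * h)
  let Z := X 0 ^ 2 * T + X 1 ^ 2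
  let Y := X 2 - X 0 * T * geomQuot h Z (X 1 ^ 2)
  ![X 1 * Y, Y, Z, T]

/-- The blow-down map of type `D` for `k = 2 h`, on the `β`-chart. -/
noncomputable def betaDEven (h : ℕ) : Fin 4 → MvPolynomial (Fin 3) ℂ :=
  let T := X 0 ^ 2 * X 2 - X 1 ^ 2
  ![X 1 * (T - X 2 ^ h), X 0 * (T - X 2 ^ h), X 2, T]

variable {h : ℕ}

theorem eval_gammaDEven (x : Fin 3 → ℂ) : (fun i => eval x (gammaDEven h i)) =
    let T := x 0 * x 2 + x 1 ^ (2 * h)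
    let Z := x 0 ^ 2 * T + x 1 ^ 2
    let Y := x 2 - x 0 * T * geomQuot h Z (x 1 ^ 2)
    ![x 1 * Y, Y, Z, T] := by
  funext i
  fin_cases i <;> simp [gammaDEven]

theorem eval_betaDEven (x : Fin 3 → ℂ) : (fun i => eval x (betaDEven h i)) =
    let T := x 0 ^ 2 * x 2 - x 1 ^ 2
    ![x 1 * (T - x 2 ^ h), x 0 * (T - x 2 ^ h), x 2, T] := by
  funext i
  fin_cases i <;> simp [betaDEven]

theorem eval_polyDEven (q : Fin 4 → ℂ) : eval q (polyDEven (2 * h)) =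
    q 0 ^ 2 - q 1 ^ 2 * q 2 + q 3 * (q 2 ^ h - q 3) ^ 2 := by
  simp [polyDEven]

/-- `γ Y = T - Z ^ h` on the `γ`-chart. -/
theorem gammaDEven_mul (g w u : ℂ) :
    g * (u - g * (g * u + w ^ (2 * h)) *
        geomQuot h (g ^ 2 * (g * u + w ^ (2 * h)) + w ^ 2) (w ^ 2)) =
      g * u + w ^ (2 * h) - (g ^ 2 * (g * u + w ^ (2 * h)) + w ^ 2) ^ h := by
  have e := geomQuot_mul h (g ^ 2 * (g * u + w ^ (2 * h)) + w ^ 2) (w ^ 2)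
  rw [← pow_mul] at e
  linear_combination -e

theorem compatible_DEven :
    Compatible (potentialD (2 * h)) (gammaDEven h) (betaDEven h) := by
  intro γ w₁ w₂ hγ i
  revert i
  rw [← funext_iff, eval_gammaDEven, eval_betaDEven, (hasDerivAt_D (2 * h) γ w₁).deriv]
  have hZ : γ ^ 3 * w₂ + (γ ^ 2 * w₁ ^ (2 * h) + w₁ ^ 2) =
      γ ^ 2 * (γ * w₂ + w₁ ^ (2 * h)) + w₁ ^ 2 := by ring
  have hT : γ⁻¹ ^ 2 * (γ ^ 2 * (γ * w₂ + w₁ ^ (2 * h)) + w₁ ^ 2) - (γ⁻¹ * w₁) ^ 2 =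
      γ * w₂ + w₁ ^ (2 * h) := by
    field_simp
    ring
  funext i
  fin_cases i
  · simp only [Fin.zero_eta, Matrix.cons_val, hZ, hT, ← gammaDEven_mul]
    field_simp
  · simp only [Fin.mk_one, Matrix.cons_val, hZ, hT, ← gammaDEven_mul]
    rw [inv_mul_cancel_left₀ hγ]
  · simp only [Fin.reduceFinMk, Matrix.cons_val, hZ]
  · simp only [Fin.reduceFinMk, Matrix.cons_val, hZ, hT]

theorem singularLocus_DEven (hh : 1 ≤ h) : singularLocus (polyDEven (2 * h)) =
    {q | q 0 = 0 ∧ q 1 = 0 ∧ q 3 = q 2 ^ h} := by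
  have h2' : 2 * h / 2 = h := by omega
  have hd0 : ∀ q, eval q (pderiv 0 (polyDEven (2 * h))) = 2 * q 0 := fun q => by
    simp [polyDEven, pderiv_X]
  have hd1 : ∀ q, eval q (pderiv 1 (polyDEven (2 * h))) = -(2 * q 1 * q 2) := fun q => by
    simp [polyDEven, pderiv_X]
    ring
  have hd2 : ∀ q, eval q (pderiv 2 (polyDEven (2 * h))) =
      -q 1 ^ 2 + 2 * q 3 * (q 2 ^ h - q 3) * (h * q 2 ^ (h - 1)) := fun q => by
    simp [polyDEven, pderiv_X]
    ring
  have hd3 : ∀ q, eval q (pderiv 3 (polyDEven (2 * h))) =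
      (q 2 ^ h - q 3) * (q 2 ^ h - 3 * q 3) := fun q => by
    simp [polyDEven, pderiv_X]
    ring
  ext q
  constructor
  · rintro ⟨-, hq⟩
    have e0 := hq 0
    have e1 := hq 1
    have e2 := hq 2
    have e3 := hq 3
    rw [hd0] at e0
    rw [hd1] at e1
    rw [hd2] at e2
    rw [hd3] at e3
    have hh0 : (h : ℂ) ≠ 0 := Nat.cast_ne_zero.2 (by omega)
    have hX : q 0 = 0 := by simpa using e0
    have hT : q 3 = q 2 ^ h := by
      rcases mul_eq_zero.1 e3 with e | e
      · linear_combination -e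
      · by_cases hZ : q 2 = 0
        · rw [hZ, zero_pow (by omega)] at e ⊢
          simpa using e
        · have hY : q 1 = 0 := by simpa [hZ] using e1
          have hpow : q 2 ^ h = 3 * q 3 := by linear_combination e
          rw [hY, hpow] at e2
          have h3 : q 3 * q 3 = 0 := by
            have : (4 * (h : ℂ) * q 2 ^ (h - 1)) * (q 3 * q 3) = 0 := by
              linear_combination e2
            refine (mul_eq_zero.1 this).resolve_left ?_
            exact mul_ne_zero (mul_ne_zero (by norm_num) hh0) (pow_ne_zero _ hZ)
          rw [hpow, mul_self_eq_zero.1 h3, mul_zero]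
    refine ⟨hX, ?_, hT⟩
    rw [hT, sub_self, mul_zero, zero_mul, add_zero] at e2
    simpa using e2
  · rintro ⟨hX, hY, hT⟩
    refine ⟨by rw [eval_polyDEven, hX, hY, hT]; ring, fun i => ?_⟩
    fin_cases i
    · exact (hd0 q).trans (by rw [hX, mul_zero])
    · exact (hd1 q).trans (by rw [hY]; ring)
    · exact (hd2 q).trans (by rw [hY, hT]; ring)
    · exact (hd3 q).trans (by rw [hT]; ring)

theorem eval_polyDEven_gammaDEven (x : Fin 3 → ℂ) :
    eval (fun i => eval x (gammaDEven h i)) (polyDEven (2 * h)) = 0 := by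
  rw [eval_gammaDEven, eval_polyDEven]
  simp only [Matrix.cons_val]
  have e := gammaDEven_mul (h := h) (x 0) (x 1) (x 2)
  generalize x 2 - x 0 * (x 0 * x 2 + x 1 ^ (2 * h)) *
    geomQuot h (x 0 ^ 2 * (x 0 * x 2 + x 1 ^ (2 * h)) + x 1 ^ 2) (x 1 ^ 2) = Y at *
  generalize x 0 * x 2 + x 1 ^ (2 * h) = T at *
  generalize (x 0 ^ 2 * T + x 1 ^ 2) ^ h = P at *
  linear_combination -T * (x 0 * Y + (T - P)) * e

theorem eval_polyDEven_betaDEven (x : Fin 3 → ℂ) :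
    eval (fun i => eval x (betaDEven h i)) (polyDEven (2 * h)) = 0 := by
  rw [eval_betaDEven, eval_polyDEven]
  simp only [Matrix.cons_val]
  ring

theorem exists_preimage_DEven {q : Fin 4 → ℂ} (hq : eval q (polyDEven (2 * h)) = 0) :
    (∃ x, ∀ i, eval x (gammaDEven h i) = q i) ∨ ∃ x, ∀ i, eval x (betaDEven h i) = q i := by
  simp_rw [← funext_iff, eval_gammaDEven, eval_betaDEven]
  rw [eval_polyDEven] at hq
  by_cases hY : q 1 = 0
  · -- over `Y = 0` one may take `β = 0` and `v₁ ^ 2 = -T`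
    obtain ⟨v, hv, hX⟩ : ∃ v, v ^ 2 = -q 3 ∧ v * (q 3 - q 2 ^ h) = q 0 := by
      by_cases hT : q 3 - q 2 ^ h = 0
      · obtain ⟨v, hv⟩ := IsAlgClosed.exists_pow_nat_eq (-q 3) two_pos
        refine ⟨v, hv, ?_⟩
        have : q 2 ^ h - q 3 = 0 := by linear_combination -hT
        rw [hY, this] at hq
        have hX : q 0 = 0 := by simpa using hq
        rw [hT, hX, mul_zero]
      · refine ⟨q 0 / (q 3 - q 2 ^ h), ?_, div_mul_cancel₀ _ hT⟩
        rw [hY] at hq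
        field_simp
        linear_combination hq
    refine Or.inr ⟨![0, v, q 2], ?_⟩
    have hT : (0 : ℂ) ^ 2 * q 2 - v ^ 2 = q 3 := by rw [hv]; ring
    funext i
    fin_cases i
    · simp only [Fin.zero_eta, Matrix.cons_val, hT, hX]
    · simp [hY]
    · simp
    · simp only [Fin.reduceFinMk, Matrix.cons_val, hT]
  · left
    obtain ⟨g, hg⟩ : ∃ g, g * q 1 = q 3 - q 2 ^ h := ⟨_, div_mul_cancel₀ _ hY⟩
    obtain ⟨w, hw⟩ : ∃ w, w * q 1 = q 0 := ⟨_, div_mul_cancel₀ _ hY⟩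
    have hZ : g ^ 2 * q 3 + w ^ 2 = q 2 := by
      refine mul_right_cancel₀ (pow_ne_zero 2 hY) ?_
      linear_combination q 3 * (g * q 1 + (q 3 - q 2 ^ h)) * hg + (w * q 1 + q 0) * hw + hq
    have hT : g * (q 1 + g * q 3 * geomQuot h (q 2) (w ^ 2)) + w ^ (2 * h) = q 3 := by
      have e := geomQuot_mul h (q 2) (w ^ 2)
      rw [← pow_mul] at e
      linear_combination e + hg + geomQuot h (q 2) (w ^ 2) * hZ
    refine ⟨![g, w, q 1 + g * q 3 * geomQuot h (q 2) (w ^ 2)], ?_⟩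
    funext i
    fin_cases i
    · simp only [Fin.zero_eta, Matrix.cons_val, hT, hZ, add_sub_cancel_right, hw]
    · simp only [Fin.mk_one, Matrix.cons_val, hT, hZ, add_sub_cancel_right]
    · simp only [Fin.reduceFinMk, Matrix.cons_val, hT, hZ]
    · simp only [Fin.reduceFinMk, Matrix.cons_val, hT]

theorem boundsCoordinates_gammaDEven : BoundsCoordinates (gammaDEven h) := by
  intro S h0 hR
  have hY : (fun x : Fin 3 → ℂ => x 2 - x 0 * (x 0 * x 2 + x 1 ^ (2 * h)) *
      geomQuot h (x 0 ^ 2 * (x 0 * x 2 + x 1 ^ (2 * h)) + x 1 ^ 2) (x 1 ^ 2)) ∈ boundedOn S := by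
    simpa [gammaDEven] using hR 1
  have hZ : (fun x : Fin 3 → ℂ => x 0 ^ 2 * (x 0 * x 2 + x 1 ^ (2 * h)) + x 1 ^ 2) ∈
      boundedOn S := by
    simpa [gammaDEven] using hR 2
  have hT : (fun x : Fin 3 → ℂ => x 0 * x 2 + x 1 ^ (2 * h)) ∈ boundedOn S := by
    simpa [gammaDEven] using hR 3
  have h1 : (fun x : Fin 3 → ℂ => x 1) ∈ boundedOn S :=
    mem_boundedOn_of_sq (sub_mem hZ (mul_mem (pow_mem h0 2) hT)) fun x => by simp
  refine ⟨h1, ?_⟩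
  convert! add_mem hY (mul_mem (mul_mem h0 hT) (geomQuot_mem hZ (pow_mem h1 2) h)) using 1
  funext x
  simp

theorem boundsCoordinates_betaDEven : BoundsCoordinates (betaDEven h) := by
  intro S h0 hR
  have h2 : (fun x : Fin 3 → ℂ => x 2) ∈ boundedOn S := by
    simpa [betaDEven] using hR 2
  have hT : (fun x : Fin 3 → ℂ => x 0 ^ 2 * x 2 - x 1 ^ 2) ∈ boundedOn S := by
    simpa [betaDEven] using hR 3
  exact ⟨mem_boundedOn_of_sq (sub_mem (mul_mem (pow_mem h0 2) h2) hT) fun x => by simp, h2⟩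

theorem gammaDEven_eq_zero_iff (hh : 1 ≤ h) (x : Fin 3 → ℂ) :
    (∀ i, eval x (gammaDEven h i) = 0) ↔ x 1 = 0 ∧ x 2 = 0 := by
  have hh0 : h ≠ 0 := by omega
  constructor
  · intro e
    have hT : x 0 * x 2 + x 1 ^ (2 * h) = 0 := by simpa [gammaDEven] using e 3
    exact ⟨by simpa [gammaDEven, hT] using e 2, by simpa [gammaDEven, hT] using e 1⟩
  · rintro ⟨h1, h2⟩ i
    fin_cases i <;> simp [gammaDEven, h1, h2, hh0]

theorem betaDEven_eq_zero_iff (hh : 1 ≤ h) (x : Fin 3 → ℂ) :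
    (∀ i, eval x (betaDEven h i) = 0) ↔ x 1 = 0 ∧ x 2 = 0 := by
  have hh0 : h ≠ 0 := by omega
  constructor
  · intro e
    have h2 : x 2 = 0 := by simpa [betaDEven] using e 2
    exact ⟨by simpa [betaDEven, h2] using e 3, h2⟩
  · rintro ⟨h1, h2⟩ i
    fin_cases i <;> simp [betaDEven, h1, h2, hh0]

theorem invertibleAway_gammaDEven : InvertibleAway (glueMap (compatible_DEven (h := h)))
    (gammaChart (potentialD (2 * h))) (X 1) := by
  have hγ := div_mem_regularAway (X 1) (X 3 - X 2 ^ h)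
  have hw := div_mem_regularAway (X 1) (X 0)
  refine invertibleAway_gammaChart _
    ![fun q => eval q (X 3 - X 2 ^ h) / eval q (X 1), fun q => eval q (X 0) / eval q (X 1),
      fun q => q 1 + eval q (X 3 - X 2 ^ h) / eval q (X 1) * q 3 *
        geomQuot h (q 2) ((eval q (X 0) / eval q (X 1)) ^ 2)] ?_ ?_ ?_
  · intro j
    fin_cases j
    · exact hγ
    · exact hw
    · exact add_mem (coord_mem_regularAway _ 1) (mul_mem (mul_mem hγ (coord_mem_regularAway _ 3))
        (geomQuot_mem (coord_mem_regularAway _ 2) (pow_mem hw 2) h))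
  · intro x hx
    have h0 : x 0 = eval (fun i => eval x (gammaDEven h i)) (X 3 - X 2 ^ h) /
        eval (fun i => eval x (gammaDEven h i)) (X 1) := by
      rw [eq_div_iff hx, eval_gammaDEven]
      simpa using gammaDEven_mul (x 0) (x 1) (x 2)
    have h1 : x 1 = eval (fun i => eval x (gammaDEven h i)) (X 0) /
        eval (fun i => eval x (gammaDEven h i)) (X 1) := by
      rw [eq_div_iff hx]
      simp [gammaDEven]
    intro j
    fin_cases j
    · exact h0
    · exact h1
    · change x 2 = _ + _ / _ * _ * geomQuot h _ ((_ / _) ^ 2)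
      rw [← h0, ← h1]
      simp [gammaDEven]
  · intro x hx
    simp [betaDEven, hx]

theorem invertibleAway_betaDEven : InvertibleAway (glueMap (compatible_DEven (h := h)))
    (betaChart (potentialD (2 * h))) (X 3 - X 2 ^ h) := by
  refine invertibleAway_betaChart _
    ![fun q => eval q (X 1) / eval q (X 3 - X 2 ^ h),
      fun q => eval q (X 0) / eval q (X 3 - X 2 ^ h), fun q => q 2] ?_ ?_ ?_
  · intro j
    fin_cases j
    exacts [div_mem_regularAway _ _, div_mem_regularAway _ _, coord_mem_regularAway _ 2]
  · intro x hx j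
    fin_cases j
    · refine (eq_div_iff hx).2 ?_
      simp [betaDEven]
    · refine (eq_div_iff hx).2 ?_
      simp [betaDEven]
    · simp [betaDEven]
  · intro x hx
    simp [gammaDEven, hx, pow_mul]

theorem isBlowDown_DEven (hh : 1 ≤ h) :
    IsBlowDown (potentialD (2 * h)) (polyDEven (2 * h)) (glueMap compatible_DEven) := by
  have hh0 : h ≠ 0 := by omega
  have hX : ∀ {i j : Fin 4}, i ≠ j → X i ∈ supported ℂ ({j}ᶜ : Set (Fin 4)) :=
    fun hij => X_mem_supported.2 hij
  have hX1 := hX (show (1 : Fin 4) ≠ 0 by decide)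
  have hX2 := hX (show (2 : Fin 4) ≠ 0 by decide)
  have hX3 := hX (show (3 : Fin 4) ≠ 0 by decide)
  refine isBlowDown_glueMap compatible_DEven (i := 0) (B := 0)
    (D := -(X 1 ^ 2 * X 2) + X 3 * (X 2 ^ h - X 3) ^ 2) (c := X 1) (e := X 3 - X 2 ^ h)
    ?_ (zero_mem _) (add_mem (neg_mem (mul_mem (pow_mem hX1 2) hX2))
      (mul_mem hX3 (pow_mem (sub_mem (pow_mem hX2 h) hX3) 2))) ?_
    eval_polyDEven_gammaDEven eval_polyDEven_betaDEven (fun q => exists_preimage_DEven)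
    boundsCoordinates_gammaDEven boundsCoordinates_betaDEven
    (gammaDEven_eq_zero_iff hh) (betaDEven_eq_zero_iff hh)
    hX1 (sub_mem hX3 (pow_mem hX2 h)) ?_ ?_ ?_
    invertibleAway_gammaDEven invertibleAway_betaDEven ?_
  · rw [polyDEven, Nat.mul_div_cancel_left h two_pos]
    ring
  · intro h
    have := congrArg (eval ![0, 0, 0, 1]) h
    simp [hh0] at this
  · intro g hg hg'
    have h0 : (X 3 - X 2 ^ h : MvPolynomial (Fin 4) ℂ) ≠ 0 := fun h => by
      simpa [hh0] using congrArg (eval ![0, 0, 0, 1]) h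
    have := dvd_pderiv_of_dvd (i := 1) h0
      (sub_mem (hX (by decide)) (pow_mem (hX (by decide)) h)) hg' hg
    rw [pderiv_X_self] at this
    exact isUnit_of_dvd_one this
  · exact ⟨![0, 0, 1], by simp [gammaDEven]⟩
  · exact ⟨![1, 1, 0], by simp [betaDEven, hh0]⟩
  · rintro q ⟨hq, hq'⟩
    by_cases hY : q 1 = 0
    · refine ⟨X 3 - X 2 ^ h, fun hd => hq' ?_, Or.inr invertibleAway_betaDEven⟩
      have hT : q 3 = q 2 ^ h := sub_eq_zero.1 (by simpa using hd)
      rw [singularLocus_DEven hh]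
      refine ⟨?_, hY, hT⟩
      have := (eval_polyDEven q).symm.trans hq
      simpa [hY, hT] using this
    · exact ⟨X 1, by simpa using hY, Or.inl invertibleAway_gammaDEven⟩

end TypeDEven

/-! ### Type `D`, odd case -/

section TypeDOdd

/-- The blow-down map of type `D` for `k = 2 h + 1`, on the `γ`-chart. In terms of the `β`-chart,
`Z = v₂`, `T = β ^ 2 Z - v₁ ^ 2`, `Y = β T - v₁ Z ^ h` and `X = v₁ T - β Z ^ (h + 1)`. -/
noncomputable def gammaDOdd (h : ℕ) : Fin 4 → MvPolynomial (Fin 3) ℂ :=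
  let T := X 0 * X 2 + X 1 ^ (2 * h + 1)
  let Z := X 0 ^ 2 * T + X 1 ^ 2
  let Y := X 2 - X 0 * X 1 * T * geomQuot h Z (X 1 ^ 2)
  ![X 1 * Y - X 0 * T * Z ^ h, Y, Z, T]

/-- The blow-down map of type `D` for `k = 2 h + 1`, on the `β`-chart. -/
noncomputable def betaDOdd (h : ℕ) : Fin 4 → MvPolynomial (Fin 3) ℂ :=
  let T := X 0 ^ 2 * X 2 - X 1 ^ 2
  ![X 1 * T - X 0 * X 2 ^ h * X 2, X 0 * T - X 1 * X 2 ^ h, X 2, T]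

variable {h : ℕ}

theorem eval_gammaDOdd (x : Fin 3 → ℂ) : (fun i => eval x (gammaDOdd h i)) =
    let T := x 0 * x 2 + x 1 ^ (2 * h + 1)
    let Z := x 0 ^ 2 * T + x 1 ^ 2
    let Y := x 2 - x 0 * x 1 * T * geomQuot h Z (x 1 ^ 2)
    ![x 1 * Y - x 0 * T * Z ^ h, Y, Z, T] := by
  funext i
  fin_cases i <;> simp [gammaDOdd]

theorem eval_betaDOdd (x : Fin 3 → ℂ) : (fun i => eval x (betaDOdd h i)) =
    let T := x 0 ^ 2 * x 2 - x 1 ^ 2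
    ![x 1 * T - x 0 * x 2 ^ h * x 2, x 0 * T - x 1 * x 2 ^ h, x 2, T] := by
  funext i
  fin_cases i <;> simp [betaDOdd]

theorem eval_polyDOdd (q : Fin 4 → ℂ) : eval q (polyDOdd (2 * h + 1)) =
    q 0 ^ 2 - q 1 ^ 2 * q 2 - q 3 * ((q 2 ^ h) ^ 2 * q 2 - q 3 ^ 2) := by
  simp only [polyDOdd, map_sub, map_mul, map_pow, eval_X]
  ring

/-- `γ Y + w₁ Z ^ h = T` on the `γ`-chart. -/
theorem gammaDOdd_mul (g w u : ℂ) :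
    g * (u - g * w * (g * u + w ^ (2 * h + 1)) *
        geomQuot h (g ^ 2 * (g * u + w ^ (2 * h + 1)) + w ^ 2) (w ^ 2)) +
      w * (g ^ 2 * (g * u + w ^ (2 * h + 1)) + w ^ 2) ^ h = g * u + w ^ (2 * h + 1) := by
  have e := geomQuot_mul h (g ^ 2 * (g * u + w ^ (2 * h + 1)) + w ^ 2) (w ^ 2)
  rw [← pow_mul] at e
  linear_combination -w * e

/-- The equations satisfied by the `γ`-chart in terms of `γ`, `w₁` and the coordinates of `ℂ⁴`. -/
theorem gammaDOdd_relations (x : Fin 3 → ℂ) {q : Fin 4 → ℂ}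
    (hq : (fun i => eval x (gammaDOdd h i)) = q) :
    x 0 * q 1 + x 1 * q 2 ^ h = q 3 ∧ x 0 ^ 2 * q 3 + x 1 ^ 2 = q 2 ∧
      x 1 * q 1 - x 0 * q 3 * q 2 ^ h = q 0 ∧
      q 1 + x 0 * x 1 * q 3 * geomQuot h (q 2) (x 1 ^ 2) = x 2 := by
  subst hq
  rw [eval_gammaDOdd]
  refine ⟨gammaDOdd_mul _ _ _, rfl, rfl, ?_⟩
  simp

/-- The equations satisfied by the `β`-chart in terms of `β`, `v₁` and the coordinates of `ℂ⁴`. -/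
theorem betaDOdd_relations (x : Fin 3 → ℂ) {q : Fin 4 → ℂ}
    (hq : (fun i => eval x (betaDOdd h i)) = q) :
    x 0 ^ 2 * q 2 - x 1 ^ 2 = q 3 ∧ x 0 * q 3 - x 1 * q 2 ^ h = q 1 ∧
      x 1 * q 3 - x 0 * q 2 ^ h * q 2 = q 0 ∧ q 2 = x 2 := by
  subst hq
  rw [eval_betaDOdd]
  exact ⟨rfl, rfl, rfl, rfl⟩

theorem compatible_DOdd :
    Compatible (potentialD (2 * h + 1)) (gammaDOdd h) (betaDOdd h) := by
  intro γ w₁ w₂ hγ i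
  revert i
  rw [← funext_iff, eval_gammaDOdd, eval_betaDOdd, (hasDerivAt_D (2 * h + 1) γ w₁).deriv]
  have hZ : γ ^ 3 * w₂ + (γ ^ 2 * w₁ ^ (2 * h + 1) + w₁ ^ 2) =
      γ ^ 2 * (γ * w₂ + w₁ ^ (2 * h + 1)) + w₁ ^ 2 := by ring
  have hT : γ⁻¹ ^ 2 * (γ ^ 2 * (γ * w₂ + w₁ ^ (2 * h + 1)) + w₁ ^ 2) - (γ⁻¹ * w₁) ^ 2 =
      γ * w₂ + w₁ ^ (2 * h + 1) := by
    field_simp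
    ring
  have e := gammaDOdd_mul (h := h) γ w₁ w₂
  funext i
  fin_cases i
  · simp only [Fin.zero_eta, Matrix.cons_val, hZ, hT]
    generalize w₂ - γ * w₁ * (γ * w₂ + w₁ ^ (2 * h + 1)) *
      geomQuot h (γ ^ 2 * (γ * w₂ + w₁ ^ (2 * h + 1)) + w₁ ^ 2) (w₁ ^ 2) = Y at *
    generalize γ * w₂ + w₁ ^ (2 * h + 1) = T at *
    generalize (γ ^ 2 * T + w₁ ^ 2) ^ h = P at *
    field_simp
    linear_combination w₁ * e
  · simp only [Fin.mk_one, Matrix.cons_val, hZ, hT]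
    rw [mul_assoc γ⁻¹ w₁, ← mul_sub, eq_inv_mul_iff_mul_eq₀ hγ]
    linear_combination e
  · simp only [Fin.reduceFinMk, Matrix.cons_val, hZ]
  · simp only [Fin.reduceFinMk, Matrix.cons_val, hZ, hT]

theorem singularLocus_DOdd : singularLocus (polyDOdd (2 * h + 1)) = {0} := by
  have hd0 : ∀ q, eval q (pderiv 0 (polyDOdd (2 * h + 1))) = 2 * q 0 := fun q => by
    simp [polyDOdd, pderiv_X]
  have hd1 : ∀ q, eval q (pderiv 1 (polyDOdd (2 * h + 1))) = -(2 * q 1 * q 2) := fun q => by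
    simp [polyDOdd, pderiv_X]
    ring
  have hd2 : ∀ q, eval q (pderiv 2 (polyDOdd (2 * h + 1))) =
      -q 1 ^ 2 - q 3 * ((2 * h + 1) * q 2 ^ (2 * h)) := fun q => by
    simp [polyDOdd, pderiv_X]
  have hd3 : ∀ q, eval q (pderiv 3 (polyDOdd (2 * h + 1))) =
      3 * q 3 ^ 2 - q 2 ^ (2 * h + 1) := fun q => by
    simp [polyDOdd, pderiv_X]
    ring
  ext q
  rw [Set.mem_singleton_iff]
  constructor
  · rintro ⟨-, hq⟩
    have e0 := hq 0
    have e1 := hq 1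
    have e2 := hq 2
    have e3 := hq 3
    rw [hd0] at e0
    rw [hd1] at e1
    rw [hd2] at e2
    rw [hd3] at e3
    have hh0 : (2 * h + 1 : ℂ) ≠ 0 := by exact_mod_cast Nat.succ_ne_zero (2 * h)
    have hX : q 0 = 0 := by simpa using e0
    have hZ : q 2 = 0 := by
      by_contra hZ
      have hY : q 1 = 0 := by simpa [hZ] using e1
      have hT : q 3 = 0 := by simpa [hY, hZ, hh0] using e2
      exact hZ (by simpa [hT] using e3)
    have hT : q 3 = 0 := by simpa [hZ] using e3
    have hY : q 1 = 0 := by simpa [hT] using e2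
    funext i
    fin_cases i
    exacts [hX, hY, hZ, hT]
  · rintro rfl
    refine ⟨(eval_polyDOdd 0).trans (by simp), fun i => ?_⟩
    fin_cases i
    · exact (hd0 0).trans (by simp)
    · exact (hd1 0).trans (by simp)
    · exact (hd2 0).trans (by simp)
    · exact (hd3 0).trans (by simp)

theorem eval_polyDOdd_gammaDOdd (x : Fin 3 → ℂ) :
    eval (fun i => eval x (gammaDOdd h i)) (polyDOdd (2 * h + 1)) = 0 := by
  obtain ⟨q, hq⟩ : ∃ q, (fun i => eval x (gammaDOdd h i)) = q := ⟨_, rfl⟩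
  obtain ⟨hT, hZ, hX, -⟩ := gammaDOdd_relations x hq
  rw [hq, eval_polyDOdd]
  generalize q 2 ^ h = P at *
  rw [← hX, ← hZ]
  linear_combination -q 3 * (x 0 * q 1 + x 1 * P + q 3) * hT

theorem eval_polyDOdd_betaDOdd (x : Fin 3 → ℂ) :
    eval (fun i => eval x (betaDOdd h i)) (polyDOdd (2 * h + 1)) = 0 := by
  rw [eval_betaDOdd, eval_polyDOdd]
  simp only [Matrix.cons_val]
  ring

theorem exists_preimage_DOdd {q : Fin 4 → ℂ} (hq : eval q (polyDOdd (2 * h + 1)) = 0) :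
    (∃ x, ∀ i, eval x (gammaDOdd h i) = q i) ∨ ∃ x, ∀ i, eval x (betaDOdd h i) = q i := by
  simp_rw [← funext_iff, eval_gammaDOdd, eval_betaDOdd]
  rw [eval_polyDOdd] at hq
  have hγ : ∀ g w, g * q 1 + w * q 2 ^ h = q 3 → g ^ 2 * q 3 + w ^ 2 = q 2 →
      w * q 1 - g * q 3 * q 2 ^ h = q 0 →
      ∃ x : Fin 3 → ℂ, (let T := x 0 * x 2 + x 1 ^ (2 * h + 1)
        let Z := x 0 ^ 2 * T + x 1 ^ 2
        let Y := x 2 - x 0 * x 1 * T * geomQuot h Z (x 1 ^ 2)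
        ![x 1 * Y - x 0 * T * Z ^ h, Y, Z, T]) = q := by
    intro g w hT hZ hX
    have hT' : g * (q 1 + g * w * q 3 * geomQuot h (q 2) (w ^ 2)) + w ^ (2 * h + 1) = q 3 := by
      have e := geomQuot_mul h (q 2) (w ^ 2)
      rw [← pow_mul] at e
      linear_combination w * e + hT + w * geomQuot h (q 2) (w ^ 2) * hZ
    refine ⟨![g, w, q 1 + g * w * q 3 * geomQuot h (q 2) (w ^ 2)], ?_⟩
    funext i
    fin_cases i
    · simp only [Fin.zero_eta, Matrix.cons_val, hT', hZ, add_sub_cancel_right, hX]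
    · simp only [Fin.mk_one, Matrix.cons_val, hT', hZ, add_sub_cancel_right]
    · simp only [Fin.reduceFinMk, Matrix.cons_val, hT', hZ]
    · simp only [Fin.reduceFinMk, Matrix.cons_val, hT']
  have hβ : ∀ b v, b ^ 2 * q 2 - v ^ 2 = q 3 → b * q 3 - v * q 2 ^ h = q 1 →
      v * q 3 - b * q 2 ^ h * q 2 = q 0 →
      ∃ x : Fin 3 → ℂ, (let T := x 0 ^ 2 * x 2 - x 1 ^ 2
        ![x 1 * T - x 0 * x 2 ^ h * x 2, x 0 * T - x 1 * x 2 ^ h, x 2, T]) = q := by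
    intro b v hT hY hX
    refine ⟨![b, v, q 2], ?_⟩
    funext i
    fin_cases i
    · simp only [Fin.zero_eta, Matrix.cons_val, hT, hX]
    · simp only [Fin.mk_one, Matrix.cons_val, hT, hY]
    · simp only [Fin.reduceFinMk, Matrix.cons_val]
    · simp only [Fin.reduceFinMk, Matrix.cons_val, hT]
  by_cases h1 : q 1 ^ 2 + q 3 * (q 2 ^ h) ^ 2 = 0
  · by_cases h3 : q 3 ^ 2 - (q 2 ^ h) ^ 2 * q 2 = 0
    · have hX2 : q 0 ^ 2 = q 1 ^ 2 * q 2 := by linear_combination hq - q 3 * h3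
      by_cases hP : q 2 ^ h = 0
      · have hY : q 1 = 0 := by simpa [hP] using h1
        have hT : q 3 = 0 := by simpa [hP] using h3
        have hX : q 0 = 0 := by simpa [hY] using hX2
        exact Or.inr (hβ 0 0 (by simp [hT]) (by simp [hY]) (by simp [hX]))
      · -- here `(X Z ^ h) ^ 2 = (Y T) ^ 2`; the sign decides between `γ = 0` and `β = 0`
        have hpm : (q 0 * q 2 ^ h - q 1 * q 3) * (q 0 * q 2 ^ h + q 1 * q 3) = 0 := by
          linear_combination (q 2 ^ h) ^ 2 * hX2 - q 1 ^ 2 * h3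
        rcases mul_eq_zero.1 hpm with e | e
        · refine Or.inl (hγ 0 (q 3 / q 2 ^ h) ?_ ?_ ?_)
          · rw [zero_mul, zero_add, div_mul_cancel₀ _ hP]
          · rw [div_pow, zero_pow two_ne_zero, zero_mul, zero_add, div_eq_iff (pow_ne_zero 2 hP)]
            linear_combination h3
          · rw [zero_mul, zero_mul, sub_zero, div_mul_eq_mul_div, div_eq_iff hP]
            linear_combination -e
        · refine Or.inr (hβ 0 (-q 1 / q 2 ^ h) ?_ ?_ ?_)
          · rw [div_pow, zero_pow two_ne_zero, zero_mul, zero_sub, neg_eq_iff_eq_neg,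
              div_eq_iff (pow_ne_zero 2 hP)]
            linear_combination h1
          · rw [zero_mul, zero_sub, div_mul_cancel₀ _ hP, neg_neg]
          · rw [zero_mul, zero_mul, sub_zero, div_mul_eq_mul_div, div_eq_iff hP]
            linear_combination -e
    · right
      generalize q 2 ^ h = P at *
      obtain ⟨b, hb⟩ : ∃ b, b * (q 3 ^ 2 - P ^ 2 * q 2) = q 1 * q 3 + q 0 * P :=
        ⟨_, div_mul_cancel₀ _ h3⟩
      obtain ⟨v, hv⟩ : ∃ v, v * (q 3 ^ 2 - P ^ 2 * q 2) = P * q 2 * q 1 + q 3 * q 0 :=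
        ⟨_, div_mul_cancel₀ _ h3⟩
      refine hβ b v ?_ ?_ ?_
      · refine mul_right_cancel₀ (pow_ne_zero 2 h3) ?_
        linear_combination q 2 * (b * (q 3 ^ 2 - P ^ 2 * q 2) + (q 1 * q 3 + q 0 * P)) * hb -
          (v * (q 3 ^ 2 - P ^ 2 * q 2) + (P * q 2 * q 1 + q 3 * q 0)) * hv -
          (q 3 ^ 2 - P ^ 2 * q 2) * hq
      · refine mul_right_cancel₀ h3 ?_
        linear_combination q 3 * hb - P * hv
      · refine mul_right_cancel₀ h3 ?_
        linear_combination q 3 * hv - P * q 2 * hb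
  · left
    generalize q 2 ^ h = P at *
    obtain ⟨g, hg⟩ : ∃ g, g * (q 1 ^ 2 + q 3 * P ^ 2) = q 3 * q 1 - q 0 * P :=
      ⟨_, div_mul_cancel₀ _ h1⟩
    obtain ⟨w, hw⟩ : ∃ w, w * (q 1 ^ 2 + q 3 * P ^ 2) = q 1 * q 0 + q 3 ^ 2 * P :=
      ⟨_, div_mul_cancel₀ _ h1⟩
    refine hγ g w ?_ ?_ ?_
    · refine mul_right_cancel₀ h1 ?_
      linear_combination q 1 * hg + P * hw
    · refine mul_right_cancel₀ (pow_ne_zero 2 h1) ?_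
      linear_combination q 3 * (g * (q 1 ^ 2 + q 3 * P ^ 2) + (q 3 * q 1 - q 0 * P)) * hg +
        (w * (q 1 ^ 2 + q 3 * P ^ 2) + (q 1 * q 0 + q 3 ^ 2 * P)) * hw +
        (q 1 ^ 2 + q 3 * P ^ 2) * hq
    · refine mul_right_cancel₀ h1 ?_
      linear_combination q 1 * hw - q 3 * P * hg

theorem boundsCoordinates_gammaDOdd : BoundsCoordinates (gammaDOdd h) := by
  intro S h0 hR
  have hY : (fun x : Fin 3 → ℂ => x 2 - x 0 * x 1 * (x 0 * x 2 + x 1 ^ (2 * h + 1)) *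
      geomQuot h (x 0 ^ 2 * (x 0 * x 2 + x 1 ^ (2 * h + 1)) + x 1 ^ 2) (x 1 ^ 2)) ∈
      boundedOn S := by
    simpa [gammaDOdd] using hR 1
  have hZ : (fun x : Fin 3 → ℂ => x 0 ^ 2 * (x 0 * x 2 + x 1 ^ (2 * h + 1)) + x 1 ^ 2) ∈
      boundedOn S := by
    simpa [gammaDOdd] using hR 2
  have hT : (fun x : Fin 3 → ℂ => x 0 * x 2 + x 1 ^ (2 * h + 1)) ∈ boundedOn S := by
    simpa [gammaDOdd] using hR 3
  have h1 : (fun x : Fin 3 → ℂ => x 1) ∈ boundedOn S :=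
    mem_boundedOn_of_sq (sub_mem hZ (mul_mem (pow_mem h0 2) hT)) fun x => by simp
  refine ⟨h1, ?_⟩
  convert! add_mem hY (mul_mem (mul_mem (mul_mem h0 h1) hT) (geomQuot_mem hZ (pow_mem h1 2) h))
    using 1
  funext x
  simp

theorem boundsCoordinates_betaDOdd : BoundsCoordinates (betaDOdd h) := by
  intro S h0 hR
  have h2 : (fun x : Fin 3 → ℂ => x 2) ∈ boundedOn S := by
    simpa [betaDOdd] using hR 2
  have hT : (fun x : Fin 3 → ℂ => x 0 ^ 2 * x 2 - x 1 ^ 2) ∈ boundedOn S := by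
    simpa [betaDOdd] using hR 3
  exact ⟨mem_boundedOn_of_sq (sub_mem (mul_mem (pow_mem h0 2) h2) hT) fun x => by simp, h2⟩

theorem gammaDOdd_eq_zero_iff (x : Fin 3 → ℂ) :
    (∀ i, eval x (gammaDOdd h i) = 0) ↔ x 1 = 0 ∧ x 2 = 0 := by
  constructor
  · intro e
    have hT : x 0 * x 2 + x 1 ^ (2 * h + 1) = 0 := by simpa [gammaDOdd] using e 3
    exact ⟨by simpa [gammaDOdd, hT] using e 2, by simpa [gammaDOdd, hT] using e 1⟩
  · rintro ⟨h1, h2⟩ i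
    fin_cases i <;> simp [gammaDOdd, h1, h2]

theorem betaDOdd_eq_zero_iff (x : Fin 3 → ℂ) :
    (∀ i, eval x (betaDOdd h i) = 0) ↔ x 1 = 0 ∧ x 2 = 0 := by
  constructor
  · intro e
    have h2 : x 2 = 0 := by simpa [betaDOdd] using e 2
    exact ⟨by simpa [betaDOdd, h2] using e 3, h2⟩
  · rintro ⟨h1, h2⟩ i
    fin_cases i <;> simp [betaDOdd, h1, h2]

/-- The `γ`-chart is inverted wherever `γ` and `w₁` can be written as fractions with
denominator `d`. -/
theorem invertibleAway_gammaDOdd {n n' d : MvPolynomial (Fin 4) ℂ}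
    (hP : ∀ x, x 0 * eval (fun i => eval x (gammaDOdd h i)) d =
      eval (fun i => eval x (gammaDOdd h i)) n)
    (hP' : ∀ x, x 1 * eval (fun i => eval x (gammaDOdd h i)) d =
      eval (fun i => eval x (gammaDOdd h i)) n')
    (hQ : ∀ x, x 0 = 0 → eval (fun i => eval x (betaDOdd h i)) d = 0) :
    InvertibleAway (glueMap (compatible_DOdd (h := h)))
      (gammaChart (potentialD (2 * h + 1))) d := by
  have hγ := div_mem_regularAway d n
  have hw := div_mem_regularAway d n'
  refine invertibleAway_gammaChart _
    ![fun q => eval q n / eval q d, fun q => eval q n' / eval q d,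
      fun q => q 1 + eval q n / eval q d * (eval q n' / eval q d) * q 3 *
        geomQuot h (q 2) ((eval q n' / eval q d) ^ 2)] ?_ ?_ hQ
  · intro j
    fin_cases j
    · exact hγ
    · exact hw
    · exact add_mem (coord_mem_regularAway _ 1) (mul_mem (mul_mem (mul_mem hγ hw)
        (coord_mem_regularAway _ 3)) (geomQuot_mem (coord_mem_regularAway _ 2) (pow_mem hw 2) h))
  · intro x hx
    have h0 := (eq_div_iff hx).2 (hP x)
    have h1 := (eq_div_iff hx).2 (hP' x)
    intro j
    fin_cases j
    · exact h0
    · exact h1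
    · change x 2 = _ + _ / _ * (_ / _) * _ * geomQuot h _ ((_ / _) ^ 2)
      rw [← h0, ← h1]
      exact (gammaDOdd_relations x rfl).2.2.2.symm

/-- The `β`-chart is inverted wherever `β` and `v₁` can be written as fractions with
denominator `d`. -/
theorem invertibleAway_betaDOdd {n n' d : MvPolynomial (Fin 4) ℂ}
    (hQ : ∀ x, x 0 * eval (fun i => eval x (betaDOdd h i)) d =
      eval (fun i => eval x (betaDOdd h i)) n)
    (hQ' : ∀ x, x 1 * eval (fun i => eval x (betaDOdd h i)) d =
      eval (fun i => eval x (betaDOdd h i)) n')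
    (hP : ∀ x, x 0 = 0 → eval (fun i => eval x (gammaDOdd h i)) d = 0) :
    InvertibleAway (glueMap (compatible_DOdd (h := h)))
      (betaChart (potentialD (2 * h + 1))) d := by
  refine invertibleAway_betaChart _
    ![fun q => eval q n / eval q d, fun q => eval q n' / eval q d, fun q => q 2] ?_ ?_ hP
  · intro j
    fin_cases j
    exacts [div_mem_regularAway _ _, div_mem_regularAway _ _, coord_mem_regularAway _ 2]
  · intro x hx j
    fin_cases j
    · exact (eq_div_iff hx).2 (hQ x)
    · exact (eq_div_iff hx).2 (hQ' x)
    · exact (betaDOdd_relations x rfl).2.2.2.symm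

/-- In the odd case `γ` is the ratio `(Y T - X Z ^ h) : (Y ^ 2 + T Z ^ (2 h))` and also the ratio
`(T ^ 2 - Z ^ (2 h + 1)) : (Y T + X Z ^ h)`, the two being equal on the hypersurface. Inverting any
of these four functions inverts one of the charts, and off the origin one of them is nonzero. -/
theorem invertibleAway_gammaDOdd_sq : InvertibleAway (glueMap (compatible_DOdd (h := h)))
    (gammaChart (potentialD (2 * h + 1))) (X 1 ^ 2 + X 3 * (X 2 ^ h) ^ 2) := by
  refine invertibleAway_gammaDOdd (n := X 3 * X 1 - X 0 * X 2 ^ h)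
    (n' := X 1 * X 0 + X 3 ^ 2 * X 2 ^ h) (fun x => ?_) (fun x => ?_) (fun x hx => ?_)
  · obtain ⟨hT, hZ, hX, -⟩ := gammaDOdd_relations (h := h) x rfl
    simp only [map_add, map_sub, map_mul, map_pow, eval_X]
    linear_combination eval x (gammaDOdd h 1) * hT - eval x (gammaDOdd h 2) ^ h * hX
  · obtain ⟨hT, hZ, hX, -⟩ := gammaDOdd_relations (h := h) x rfl
    simp only [map_add, map_mul, map_pow, eval_X]
    linear_combination eval x (gammaDOdd h 3) * eval x (gammaDOdd h 2) ^ h * hT +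
      eval x (gammaDOdd h 1) * hX
  · simp [betaDOdd, hx]
    ring

theorem invertibleAway_gammaDOdd_add : InvertibleAway (glueMap (compatible_DOdd (h := h)))
    (gammaChart (potentialD (2 * h + 1))) (X 1 * X 3 + X 0 * X 2 ^ h) := by
  refine invertibleAway_gammaDOdd (n := X 3 ^ 2 - (X 2 ^ h) ^ 2 * X 2)
    (n' := X 2 ^ h * X 2 * X 1 + X 3 * X 0) (fun x => ?_) (fun x => ?_) (fun x hx => ?_)
  · obtain ⟨q, hq⟩ : ∃ q, (fun i => eval x (gammaDOdd h i)) = q := ⟨_, rfl⟩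
    obtain ⟨hT, hZ, hX, -⟩ := gammaDOdd_relations x hq
    simp only [hq, map_add, map_sub, map_mul, map_pow, eval_X]
    generalize q 2 ^ h = P at *
    rw [← hX, ← hZ]
    linear_combination (q 3 + x 1 * P) * hT
  · obtain ⟨q, hq⟩ : ∃ q, (fun i => eval x (gammaDOdd h i)) = q := ⟨_, rfl⟩
    obtain ⟨hT, hZ, hX, -⟩ := gammaDOdd_relations x hq
    simp only [hq, map_add, map_mul, map_pow, eval_X]
    generalize q 2 ^ h = P at *
    rw [← hX, ← hZ]
    linear_combination -x 0 * q 3 * P * hT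
  · simp [betaDOdd, hx]
    ring

theorem invertibleAway_betaDOdd_sq : InvertibleAway (glueMap (compatible_DOdd (h := h)))
    (betaChart (potentialD (2 * h + 1))) (X 3 ^ 2 - (X 2 ^ h) ^ 2 * X 2) := by
  refine invertibleAway_betaDOdd (n := X 1 * X 3 + X 0 * X 2 ^ h)
    (n' := X 2 ^ h * X 2 * X 1 + X 3 * X 0) (fun x => ?_) (fun x => ?_) (fun x hx => ?_)
  · simp [betaDOdd]
    ring
  · simp [betaDOdd]
    ring
  · simp [gammaDOdd, hx]
    ring

theorem invertibleAway_betaDOdd_sub : InvertibleAway (glueMap (compatible_DOdd (h := h)))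
    (betaChart (potentialD (2 * h + 1))) (X 1 * X 3 - X 0 * X 2 ^ h) := by
  refine invertibleAway_betaDOdd (n := X 1 ^ 2 + X 3 * (X 2 ^ h) ^ 2)
    (n' := X 1 * X 0 + X 3 ^ 2 * X 2 ^ h) (fun x => ?_) (fun x => ?_) (fun x hx => ?_)
  · simp [betaDOdd]
    ring
  · simp [betaDOdd]
    ring
  · simp [gammaDOdd, hx]
    ring

/-- The second polynomial does not involve `Y`, and the second `Y`-derivative of the first is the
constant `2`. -/
theorem isRelPrime_DOdd : IsRelPrime
    (X 1 ^ 2 + X 3 * (X 2 ^ h) ^ 2 : MvPolynomial (Fin 4) ℂ) (X 3 ^ 2 - (X 2 ^ h) ^ 2 * X 2) := by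
  intro g hg hg'
  have hX2 : X 2 ∈ supported ℂ ({1}ᶜ : Set (Fin 4)) := X_mem_supported.2 (by decide)
  have hX3 : X 3 ∈ supported ℂ ({1}ᶜ : Set (Fin 4)) := X_mem_supported.2 (by decide)
  have h0 : (X 3 ^ 2 - (X 2 ^ h) ^ 2 * X 2 : MvPolynomial (Fin 4) ℂ) ≠ 0 := fun h => by
    simpa using congrArg (eval ![0, 0, 0, 1]) h
  have hmem := sub_mem (pow_mem hX3 2) (mul_mem (pow_mem (pow_mem hX2 h) 2) hX2)
  have h1 := dvd_pderiv_of_dvd h0 hmem hg' (dvd_pderiv_of_dvd h0 hmem hg' hg)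
  have h2 : pderiv 1 (pderiv 1 (X 1 ^ 2 + X 3 * (X 2 ^ h) ^ 2 : MvPolynomial (Fin 4) ℂ)) =
      C 2 := by
    have e : pderiv 1 (X 1 ^ 2 + X 3 * (X 2 ^ h) ^ 2 : MvPolynomial (Fin 4) ℂ) = C 2 * X 1 := by
      rw [map_ofNat C 2]
      simp [pderiv_X]
    rw [e, pderiv_C_mul, pderiv_X_self, mul_one]
  rw [h2] at h1
  exact isUnit_of_dvd_unit h1 ((isUnit_iff_ne_zero.2 two_ne_zero).map C)

theorem isBlowDown_DOdd : IsBlowDown (potentialD (2 * h + 1)) (polyDOdd (2 * h + 1))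
    (glueMap compatible_DOdd) := by
  have hX1 : X 1 ∈ supported ℂ ({0}ᶜ : Set (Fin 4)) := X_mem_supported.2 (by decide)
  have hX2 : X 2 ∈ supported ℂ ({0}ᶜ : Set (Fin 4)) := X_mem_supported.2 (by decide)
  have hX3 : X 3 ∈ supported ℂ ({0}ᶜ : Set (Fin 4)) := X_mem_supported.2 (by decide)
  refine isBlowDown_glueMap compatible_DOdd (i := 0) (B := 0)
    (D := -(X 1 ^ 2 * X 2) - X 3 * (X 2 ^ (2 * h + 1) - X 3 ^ 2))
    (c := X 1 ^ 2 + X 3 * (X 2 ^ h) ^ 2) (e := X 3 ^ 2 - (X 2 ^ h) ^ 2 * X 2)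
    ?_ (zero_mem _) (sub_mem (neg_mem (mul_mem (pow_mem hX1 2) hX2))
      (mul_mem hX3 (sub_mem (pow_mem hX2 _) (pow_mem hX3 2)))) ?_
    eval_polyDOdd_gammaDOdd eval_polyDOdd_betaDOdd (fun q => exists_preimage_DOdd)
    boundsCoordinates_gammaDOdd boundsCoordinates_betaDOdd
    gammaDOdd_eq_zero_iff betaDOdd_eq_zero_iff
    (add_mem (pow_mem hX1 2) (mul_mem hX3 (pow_mem (pow_mem hX2 h) 2)))
    (sub_mem (pow_mem hX3 2) (mul_mem (pow_mem (pow_mem hX2 h) 2) hX2)) isRelPrime_DOdd ?_ ?_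
    invertibleAway_gammaDOdd_sq invertibleAway_betaDOdd_sq ?_
  · rw [polyDOdd]
    ring
  · intro h
    have := congrArg (eval ![0, 0, 0, 1]) h
    simp at this
  · exact ⟨![0, 0, 1], by simp [gammaDOdd]⟩
  · refine ⟨![1, 0, 1], by simp [betaDOdd]⟩
  · rintro q ⟨hq, hq'⟩
    rw [singularLocus_DOdd, Set.mem_singleton_iff] at hq'
    by_cases h1 : eval q (X 1 ^ 2 + X 3 * (X 2 ^ h) ^ 2) = 0
    · by_cases h3 : eval q (X 3 ^ 2 - (X 2 ^ h) ^ 2 * X 2) = 0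
      · by_cases h2 : eval q (X 1 * X 3 + X 0 * X 2 ^ h) = 0
        · refine ⟨_, fun h4 => hq' ?_, Or.inr invertibleAway_betaDOdd_sub⟩
          have hq := (eval_polyDOdd q).symm.trans hq
          simp only [map_add, map_sub, map_mul, map_pow, eval_X] at h1 h2 h3 h4
          have hYT : q 1 * q 3 = 0 := by linear_combination h2 / 2 + h4 / 2
          have hT : q 3 = 0 := by
            by_contra hT
            have hY : q 1 = 0 := (mul_eq_zero.1 hYT).resolve_right hT
            have hP : q 2 ^ h = 0 := by
              rw [hY] at h1
              simpa [hT] using h1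
            rw [hP] at h3
            exact hT (by simpa using h3)
          have hY : q 1 = 0 := by simpa [hT] using h1
          have hZ : q 2 = 0 := by
            rw [hT, ← pow_mul, ← pow_succ] at h3
            simpa using h3
          have hX : q 0 = 0 := by simpa [hT, hY] using hq
          funext i
          fin_cases i
          exacts [hX, hY, hZ, hT]
        · exact ⟨_, h2, Or.inl invertibleAway_gammaDOdd_add⟩
      · exact ⟨_, h3, Or.inr invertibleAway_betaDOdd_sq⟩
    · exact ⟨_, h1, Or.inl invertibleAway_gammaDOdd_sq⟩

end TypeDOdd

/-! ### Type `E₇` -/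

section TypeE7

theorem superpotential_E7 (x y : ℂ) :
    superpotential potentialE7 x y = 1 / 3 * y ^ 3 + y * x ^ 3 := by
  rw [superpotential_eq_coeff (Polynomial.C (1 / 3 * x ^ 3)
      + Polynomial.C (x ^ 2 * y) * Polynomial.X
      + Polynomial.C (x * y ^ 2 + x ^ 4 / 4) * Polynomial.X ^ 2
      + Polynomial.C (1 / 3 * y ^ 3 + y * x ^ 3) * Polynomial.X ^ 3
      + Polynomial.C (3 / 2 * x ^ 2 * y ^ 2) * Polynomial.X ^ 4
      + Polynomial.C (x * y ^ 3) * Polynomial.X ^ 5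
      + Polynomial.C (y ^ 4 / 4) * Polynomial.X ^ 6) 3 fun γ hγ => ?_]
  · simp only [Polynomial.coeff_add, Polynomial.coeff_C_mul, Polynomial.coeff_C,
      Polynomial.coeff_X, Polynomial.coeff_X_pow]
    norm_num
  · simp only [potentialE7, Polynomial.eval_add, Polynomial.eval_mul, Polynomial.eval_C,
      Polynomial.eval_pow, Polynomial.eval_X]
    field_simp
    ring

theorem hasDerivAt_E7 (γ w : ℂ) :
    HasDerivAt (potentialE7 γ) (γ⁻¹ * w ^ 2 + γ * w ^ 3) w := by
  have h := (((hasDerivAt_pow 3 w).const_mul γ⁻¹).div_const 3).add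
    (((hasDerivAt_pow 4 w).const_mul γ).div_const 4)
  convert! h using 1
  push_cast
  ring

/-- The blow-down map of type `E₇` on the `γ`-chart. In terms of the `β`-chart,
`Z = β v₂ - v₁ ^ 2`, `T = v₁ v₂ - β ^ 2 Z`, `Y = v₂ ^ 2 - β v₁ Z` and `X = γ (T ^ 2 + Z Y)`. -/
noncomputable def gammaE7 : Fin 4 → MvPolynomial (Fin 3) ℂ :=
  let Z := X 0 ^ 2 * X 2 + X 1 ^ 3
  let Y := X 0 ^ 2 * Z ^ 2 + 2 * Z * X 1 ^ 2 - X 1 * X 2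
  let T := X 1 * Z - X 2
  ![X 0 * (T ^ 2 + Z * Y), Y, Z, T]

/-- The blow-down map of type `E₇` on the `β`-chart. Its first coordinate is `(T ^ 2 + Z Y) / β`,
with the division carried out. -/
noncomputable def betaE7 : Fin 4 → MvPolynomial (Fin 3) ℂ :=
  let Z := X 0 * X 2 - X 1 ^ 2
  let T := X 1 * X 2 - X 0 ^ 2 * Z
  ![X 2 ^ 3 - X 1 * Z ^ 2 - X 0 ^ 3 * Z ^ 2 - 2 * X 0 * Z * T,
    X 2 ^ 2 - X 0 * X 1 * Z, Z, T]

theorem eval_gammaE7 (x : Fin 3 → ℂ) : (fun i => eval x (gammaE7 i)) =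
    let Z := x 0 ^ 2 * x 2 + x 1 ^ 3
    let Y := x 0 ^ 2 * Z ^ 2 + 2 * Z * x 1 ^ 2 - x 1 * x 2
    let T := x 1 * Z - x 2
    ![x 0 * (T ^ 2 + Z * Y), Y, Z, T] := by
  funext i
  fin_cases i <;> simp [gammaE7]

theorem eval_betaE7 (x : Fin 3 → ℂ) : (fun i => eval x (betaE7 i)) =
    let Z := x 0 * x 2 - x 1 ^ 2
    let T := x 1 * x 2 - x 0 ^ 2 * Z
    ![x 2 ^ 3 - x 1 * Z ^ 2 - x 0 ^ 3 * Z ^ 2 - 2 * x 0 * Z * T,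
      x 2 ^ 2 - x 0 * x 1 * Z, Z, T] := by
  funext i
  fin_cases i <;> simp [betaE7]

theorem compatible_E7 : Compatible potentialE7 gammaE7 betaE7 := by
  intro γ w₁ w₂ hγ i
  revert i
  rw [← funext_iff, eval_gammaE7, eval_betaE7, (hasDerivAt_E7 γ w₁).deriv]
  funext i
  fin_cases i <;> simp <;> field_simp <;> ring

theorem eval_polyE7 (q : Fin 4 → ℂ) : eval q polyE7 =
    q 0 ^ 2 - q 1 ^ 3 + q 2 ^ 5 + 3 * q 3 * q 1 * q 2 ^ 2 + q 3 ^ 3 * q 2 := by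
  simp [polyE7]

/-- The locus where the coordinate `γ = X / (T ^ 2 + Z Y)` is indeterminate is the singular
curve. -/
theorem exists_eq_curve_E7 {q : Fin 4 → ℂ} (hq : eval q polyE7 = 0) (h0 : q 0 = 0)
    (hd : q 3 ^ 2 + q 2 * q 1 = 0) : ∃ t : ℂ, q = ![0, -t ^ 5, t ^ 3, t ^ 4] := by
  rw [eval_polyE7, h0] at hq
  by_cases hZ : q 2 = 0
  · simp only [hZ, zero_mul, add_zero, ne_eq, OfNat.ofNat_ne_zero, not_false_eq_true,
      pow_eq_zero_iff] at hd
    simp only [hZ, hd, ne_eq, OfNat.ofNat_ne_zero, not_false_eq_true, zero_pow, mul_zero, zero_mul,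
      add_zero, zero_sub, neg_eq_zero, pow_eq_zero_iff] at hq
    refine ⟨0, ?_⟩
    funext i
    fin_cases i <;> simp [h0, hZ, hd, hq]
  · have hY : q 1 = -q 3 ^ 2 / q 2 := by
      rw [eq_div_iff hZ]
      linear_combination hd
    have hT : q 3 ^ 3 = q 2 ^ 4 := by
      have : (q 3 ^ 3 - q 2 ^ 4) ^ 2 = 0 := by
        rw [hY] at hq
        field_simp at hq
        linear_combination hq
      exact sub_eq_zero.1 (pow_eq_zero_iff two_ne_zero |>.1 this)
    refine ⟨q 3 / q 2, ?_⟩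
    funext i
    fin_cases i
    · exact h0
    · simp only [hY, Fin.mk_one, Matrix.cons_val]
      field_simp
      linear_combination q 3 ^ 2 * hT
    · simp only [Fin.reduceFinMk, Matrix.cons_val]
      field_simp
      linear_combination -hT
    · simp only [Fin.reduceFinMk, Matrix.cons_val]
      field_simp
      linear_combination -q 3 * hT

theorem singularLocus_E7 : singularLocus polyE7 =
    {q | ∃ t : ℂ, q = ![0, -t ^ 5, t ^ 3, t ^ 4]} := by
  have h3 : ∀ i, pderiv i (3 : MvPolynomial (Fin 4) ℂ) = 0 := fun i => by
    simpa using (pderiv i).map_natCast 3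
  have hd0 : ∀ q, eval q (pderiv 0 polyE7) = 2 * q 0 := fun q => by
    simp [polyE7, h3, pderiv_X]
  have hd1 : ∀ q, eval q (pderiv 1 polyE7) = -(3 * q 1 ^ 2) + 3 * q 3 * q 2 ^ 2 := fun q => by
    simp [polyE7, h3, pderiv_X]
    ring
  have hd2 : ∀ q, eval q (pderiv 2 polyE7) =
      5 * q 2 ^ 4 + 6 * q 3 * q 1 * q 2 + q 3 ^ 3 := fun q => by
    simp [polyE7, h3, pderiv_X]
    ring
  have hd3 : ∀ q, eval q (pderiv 3 polyE7) = 3 * q 1 * q 2 ^ 2 + 3 * q 3 ^ 2 * q 2 := fun q => by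
    simp [polyE7, h3, pderiv_X]
    ring
  ext q
  constructor
  · rintro ⟨hq, hq'⟩
    have h0 : q 0 = 0 := by simpa [hd0] using hq' 0
    have h2 := hq' 2
    have h3 := hq' 3
    rw [hd2] at h2
    rw [hd3] at h3
    refine exists_eq_curve_E7 hq h0 ?_
    by_cases hZ : q 2 = 0
    · rw [hZ] at h2
      have : q 3 = 0 := by simpa using h2
      simp [hZ, this]
    · refine mul_left_cancel₀ hZ ?_
      linear_combination h3 / 3
  · rintro ⟨t, rfl⟩
    refine ⟨?_, Fin.forall_fin_succ.2 ⟨?_, Fin.forall_fin_succ.2 ⟨?_,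
      Fin.forall_fin_succ.2 ⟨?_, Fin.forall_fin_one.2 ?_⟩⟩⟩⟩
    · rw [eval_polyE7]
      simp only [Matrix.cons_val]
      ring
    · simp [hd0]
    · simp [hd1]
      ring
    · simp [hd2]
      ring
    · simp [hd3]
      ring

theorem eval_polyE7_gammaE7 (x : Fin 3 → ℂ) :
    eval (fun i => eval x (gammaE7 i)) polyE7 = 0 := by
  rw [eval_gammaE7, eval_polyE7]
  simp only [Matrix.cons_val]
  ring

theorem eval_polyE7_betaE7 (x : Fin 3 → ℂ) :
    eval (fun i => eval x (betaE7 i)) polyE7 = 0 := by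
  rw [eval_betaE7, eval_polyE7]
  simp only [Matrix.cons_val]
  ring

theorem exists_preimage_E7 {q : Fin 4 → ℂ} (hq : eval q polyE7 = 0) :
    (∃ x, ∀ i, eval x (gammaE7 i) = q i) ∨ ∃ x, ∀ i, eval x (betaE7 i) = q i := by
  simp_rw [← funext_iff, eval_gammaE7, eval_betaE7]
  by_cases hD : q 3 ^ 2 + q 2 * q 1 = 0
  · by_cases h0 : q 0 = 0
    · obtain ⟨t, rfl⟩ := exists_eq_curve_E7 hq h0 hD
      obtain ⟨s, hs⟩ := IsAlgClosed.exists_pow_nat_eq (-3 : ℂ) two_pos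
      -- over a singular point, `γ = 0` and `w₁` is `t` times a primitive cube root of unity
      obtain ⟨ω, hω⟩ : ∃ ω : ℂ, ω ^ 2 + ω + 1 = 0 :=
        ⟨(-1 + s) / 2, by linear_combination hs / 4⟩
      refine Or.inl ⟨![0, ω * t, (ω - 1) * t ^ 4], ?_⟩
      funext i
      fin_cases i
      · simp
      · simp
        linear_combination t ^ 5 * (2 * ω ^ 3 - 2 * ω ^ 2 + 1) * hω
      · simp
        linear_combination t ^ 3 * (ω - 1) * hω
      · simp
        linear_combination t ^ 4 * ω * (ω - 1) * hω
    · right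
      refine ⟨![(q 3 ^ 2 + q 2 * q 1) / q 0, (q 2 ^ 3 + q 3 * q 1) / q 0,
        (q 1 ^ 2 - q 3 * q 2 ^ 2) / q 0], ?_⟩
      rw [eval_polyE7] at hq
      set b := (q 3 ^ 2 + q 2 * q 1) / q 0 with hb
      set v := (q 2 ^ 3 + q 3 * q 1) / q 0 with hv
      set u := (q 1 ^ 2 - q 3 * q 2 ^ 2) / q 0 with hu
      have hZ : b * u - v ^ 2 = q 2 := by
        rw [hb, hv, hu]
        field_simp
        linear_combination -q 2 * hq
      have hT : v * u - b ^ 2 * q 2 = q 3 := by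
        rw [hb, hv, hu]
        field_simp
        linear_combination -q 3 * hq
      have hY : u ^ 2 - b * v * q 2 = q 1 := by
        rw [hb, hv, hu]
        field_simp
        linear_combination -q 1 * hq
      have hX : u ^ 3 - v * q 2 ^ 2 - b ^ 3 * q 2 ^ 2 - 2 * b * q 2 * q 3 = q 0 := by
        rw [hb, hv, hu]
        field_simp
        linear_combination -(q 2 ^ 2 * (q 2 ^ 3 + q 3 * q 1) + 2 * q 3 * q 2 * (q 3 ^ 2 + q 2 * q 1)
          + q 0 ^ 2 + (q 1 ^ 3 - q 2 ^ 5 - 3 * q 3 * q 1 * q 2 ^ 2 - q 3 ^ 3 * q 2)) * hq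
      funext i
      fin_cases i
      · simp only [Fin.zero_eta, Matrix.cons_val, hZ, hT, hX]
      · simp only [Fin.mk_one, Matrix.cons_val, hZ, hY]
      · simp only [Fin.reduceFinMk, Matrix.cons_val, hZ]
      · simp only [Fin.reduceFinMk, Matrix.cons_val, hZ, hT]
  · left
    refine ⟨![q 0 / (q 3 ^ 2 + q 2 * q 1), (q 2 ^ 3 + q 3 * q 1) / (q 3 ^ 2 + q 2 * q 1),
        -q 3 + q 2 * ((q 2 ^ 3 + q 3 * q 1) / (q 3 ^ 2 + q 2 * q 1))], ?_⟩
    rw [eval_polyE7] at hq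
    set g := q 0 / (q 3 ^ 2 + q 2 * q 1) with hg
    set w := (q 2 ^ 3 + q 3 * q 1) / (q 3 ^ 2 + q 2 * q 1) with hw
    have hg' : g * (q 3 ^ 2 + q 2 * q 1) = q 0 := div_mul_cancel₀ _ hD
    have hZ : g ^ 2 * (-q 3 + q 2 * w) + w ^ 3 = q 2 := by
      refine mul_right_cancel₀ (pow_ne_zero 3 hD) ?_
      rw [hg, hw]
      field_simp
      linear_combination (-q 3 * (q 3 ^ 2 + q 2 * q 1) + q 2 * (q 2 ^ 3 + q 3 * q 1)) * hq
    have hY : g ^ 2 * q 2 ^ 2 + 2 * q 2 * w ^ 2 - w * (-q 3 + q 2 * w) = q 1 := by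
      rw [hg, hw]
      field_simp
      linear_combination q 2 ^ 2 * hq
    funext i
    fin_cases i
    · simp only [Fin.zero_eta, Matrix.cons_val, hZ, hY]
      linear_combination hg'
    · simp only [Fin.mk_one, Matrix.cons_val, hZ, hY]
    · simp only [Fin.reduceFinMk, Matrix.cons_val, hZ]
    · simp only [Fin.reduceFinMk, Matrix.cons_val, hZ]
      ring

theorem boundsCoordinates_gammaE7 : BoundsCoordinates gammaE7 := by
  intro S h0 hR
  have hZ : (fun x : Fin 3 → ℂ => x 0 ^ 2 * x 2 + x 1 ^ 3) ∈ boundedOn S := by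
    simpa [gammaE7] using hR 2
  have hT : (fun x : Fin 3 → ℂ => x 1 * (x 0 ^ 2 * x 2 + x 1 ^ 3) - x 2) ∈ boundedOn S := by
    simpa [gammaE7] using hR 3
  -- `w₁ ^ 3 = -γ ^ 2 Z w₁ + Z + γ ^ 2 T`
  have h1 : (fun x : Fin 3 → ℂ => x 1) ∈ boundedOn S := by
    refine mem_boundedOn_of_monic (n := 2) (a := fun j => match j with
      | 0 => fun x => (x 0 ^ 2 * x 2 + x 1 ^ 3) +
          x 0 ^ 2 * (x 1 * (x 0 ^ 2 * x 2 + x 1 ^ 3) - x 2)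
      | 1 => fun x => -(x 0 ^ 2 * (x 0 ^ 2 * x 2 + x 1 ^ 3))
      | _ => 0) ?_ ?_
    · rintro (_ | _ | j)
      · exact add_mem hZ (mul_mem (pow_mem h0 2) hT)
      · exact neg_mem (mul_mem (pow_mem h0 2) hZ)
      · exact zero_mem _
    · intro x
      simp only [Finset.sum_range_succ, Finset.sum_range_zero, Pi.zero_apply]
      ring
  refine ⟨h1, ?_⟩
  convert! sub_mem (mul_mem h1 hZ) hT using 1
  funext x
  simp

theorem boundsCoordinates_betaE7 : BoundsCoordinates betaE7 := by
  intro S h0 hR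
  have hZ : (fun x : Fin 3 → ℂ => x 0 * x 2 - x 1 ^ 2) ∈ boundedOn S := by
    simpa [betaE7] using hR 2
  have hY : (fun x : Fin 3 → ℂ => x 2 ^ 2 - x 0 * x 1 * (x 0 * x 2 - x 1 ^ 2)) ∈ boundedOn S := by
    simpa [betaE7] using hR 1
  -- eliminate `v₁` from `v₁ ^ 2 = β v₂ - Z` and `v₂ ^ 2 = Y + β v₁ Z`
  have h2 : (fun x : Fin 3 → ℂ => x 2) ∈ boundedOn S := by
    refine mem_boundedOn_of_monic (n := 3) (a := fun j => match j with
      | 0 => fun x => -((x 2 ^ 2 - x 0 * x 1 * (x 0 * x 2 - x 1 ^ 2)) ^ 2 +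
          x 0 ^ 2 * (x 0 * x 2 - x 1 ^ 2) ^ 3)
      | 1 => fun x => x 0 ^ 3 * (x 0 * x 2 - x 1 ^ 2) ^ 2
      | 2 => fun x => (x 2 ^ 2 - x 0 * x 1 * (x 0 * x 2 - x 1 ^ 2)) +
          (x 2 ^ 2 - x 0 * x 1 * (x 0 * x 2 - x 1 ^ 2))
      | _ => 0) ?_ ?_
    · rintro (_ | _ | _ | j)
      · exact neg_mem (add_mem (pow_mem hY 2) (mul_mem (pow_mem h0 2) (pow_mem hZ 3)))
      · exact mul_mem (pow_mem h0 3) (pow_mem hZ 2)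
      · exact add_mem hY hY
      · exact zero_mem _
    · intro x
      simp only [Finset.sum_range_succ, Finset.sum_range_zero, Pi.zero_apply]
      ring
  refine ⟨mem_boundedOn_of_sq (sub_mem (mul_mem h0 h2) hZ) fun x => ?_, h2⟩
  simp

theorem gammaE7_eq_zero_iff (x : Fin 3 → ℂ) :
    (∀ i, eval x (gammaE7 i) = 0) ↔ x 1 = 0 ∧ x 2 = 0 := by
  constructor
  · intro h
    have hZ : x 0 ^ 2 * x 2 + x 1 ^ 3 = 0 := by simpa [gammaE7] using h 2
    have hT : x 2 = 0 := by simpa [gammaE7, hZ] using h 3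
    exact ⟨by simpa [hT] using hZ, hT⟩
  · rintro ⟨h1, h2⟩ i
    fin_cases i <;> simp [gammaE7, h1, h2]

theorem betaE7_eq_zero_iff (x : Fin 3 → ℂ) :
    (∀ i, eval x (betaE7 i) = 0) ↔ x 1 = 0 ∧ x 2 = 0 := by
  constructor
  · intro h
    have hZ : x 0 * x 2 - x 1 ^ 2 = 0 := by simpa [betaE7] using h 2
    have hY : x 2 = 0 := by simpa [betaE7, hZ] using h 1
    exact ⟨by simpa [hY] using hZ, hY⟩
  · rintro ⟨h1, h2⟩ i
    fin_cases i <;> simp [betaE7, h1, h2]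

theorem invertibleAway_gammaE7 :
    InvertibleAway (glueMap compatible_E7) (gammaChart potentialE7) (X 3 ^ 2 + X 2 * X 1) := by
  refine invertibleAway_gammaChart _
    ![fun q => eval q (X 0) / eval q (X 3 ^ 2 + X 2 * X 1),
      fun q => eval q (X 2 ^ 3 + X 3 * X 1) / eval q (X 3 ^ 2 + X 2 * X 1),
      fun q => -q 3 + q 2 * (eval q (X 2 ^ 3 + X 3 * X 1) / eval q (X 3 ^ 2 + X 2 * X 1))]
    ?_ ?_ ?_
  · intro j
    fin_cases j
    · exact div_mem_regularAway _ _
    · exact div_mem_regularAway _ _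
    · exact add_mem (neg_mem (coord_mem_regularAway _ 3))
        (mul_mem (coord_mem_regularAway _ 2) (div_mem_regularAway _ _))
  · intro x hx
    have hw : x 1 = eval (fun i => eval x (gammaE7 i)) (X 2 ^ 3 + X 3 * X 1) /
        eval (fun i => eval x (gammaE7 i)) (X 3 ^ 2 + X 2 * X 1) := by
      rw [eq_div_iff hx, eval_gammaE7]
      simp only [map_add, map_mul, map_pow, eval_X, Matrix.cons_val]
      ring
    intro j
    fin_cases j
    · change x 0 = _ / _
      rw [eq_div_iff hx, eval_gammaE7]
      simp only [map_add, map_mul, map_pow, eval_X, Matrix.cons_val]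
    · exact hw
    · change x 2 = -_ + _ * (_ / _)
      rw [← hw]
      simp [gammaE7]
      ring
  · intro x hx
    rw [eval_betaE7]
    simp only [map_add, map_mul, map_pow, eval_X, Matrix.cons_val, hx]
    ring

/-- The image of `X ^ 2` in terms of the other coordinates. -/
noncomputable def branchE7 : MvPolynomial (Fin 4) ℂ :=
  X 1 ^ 3 - X 2 ^ 5 - 3 * X 3 * X 1 * X 2 ^ 2 - X 3 ^ 3 * X 2

theorem invertibleAway_betaE7 :
    InvertibleAway (glueMap compatible_E7) (betaChart potentialE7) (X 0) := by
  refine invertibleAway_betaChart _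
    ![fun q => eval q (X 3 ^ 2 + X 2 * X 1) / eval q (X 0),
      fun q => eval q (X 2 ^ 3 + X 3 * X 1) / eval q (X 0),
      fun q => eval q (X 1 ^ 2 - X 3 * X 2 ^ 2) / eval q (X 0)] ?_ ?_ ?_
  · intro j
    fin_cases j <;> exact div_mem_regularAway _ _
  · intro x hx j
    fin_cases j <;> refine (eq_div_iff hx).2 ?_ <;> rw [eval_betaE7] <;>
      simp only [map_add, map_sub, map_mul, map_pow, eval_X, Matrix.cons_val, Fin.zero_eta,
        Fin.mk_one, Fin.reduceFinMk] <;> ring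
  · intro x hx
    rw [eval_gammaE7]
    simp [hx]

theorem branchE7_mem_supported : branchE7 ∈ supported ℂ ({0}ᶜ : Set (Fin 4)) := by
  have h : ∀ i : Fin 4, i ≠ 0 → X i ∈ supported ℂ ({0}ᶜ : Set (Fin 4)) :=
    fun i hi => X_mem_supported.2 hi
  have h1 := h 1 (by decide)
  have h2 := h 2 (by decide)
  have h3 := h 3 (by decide)
  exact sub_mem (sub_mem (sub_mem (pow_mem h1 3) (pow_mem h2 5))
    (mul_mem (mul_mem (mul_mem (natCast_mem _ 3) h3) h1) (pow_mem h2 2)))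
    (mul_mem (pow_mem h3 3) h2)

/-- Eliminating `Y` leaves `(T ^ 3 - Z ^ 4) ^ 2`, so a common divisor does not involve `Y`; hence it
divides both `Z` and `T ^ 2`. -/
theorem isRelPrime_E7 : IsRelPrime (X 3 ^ 2 + X 2 * X 1) branchE7 := by
  intro g hg hg'
  have hr0 : (X 3 ^ 3 - X 2 ^ 4 : MvPolynomial (Fin 4) ℂ) ^ 2 ≠ 0 := fun h => by
    simpa using congrArg (eval ![0, 0, 0, 1]) h
  have hr : (X 3 ^ 3 - X 2 ^ 4 : MvPolynomial (Fin 4) ℂ) ^ 2 ∈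
      supported ℂ ({1}ᶜ : Set (Fin 4)) :=
    pow_mem (sub_mem (pow_mem (X_mem_supported.2 (by decide)) 3)
      (pow_mem (X_mem_supported.2 (by decide)) 4)) 2
  have hgr : g ∣ (X 3 ^ 3 - X 2 ^ 4) ^ 2 := by
    have e : (X 3 ^ 3 - X 2 ^ 4 : MvPolynomial (Fin 4) ℂ) ^ 2 = (X 3 ^ 2 + X 2 * X 1) *
        (X 2 ^ 2 * X 1 ^ 2 - X 1 * X 2 * X 3 ^ 2 + X 3 ^ 4 - 3 * X 2 ^ 4 * X 3)
        + branchE7 * (-X 2 ^ 3) := by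
      rw [branchE7]
      ring
    rw [e]
    exact dvd_add (hg.mul_right _) (hg'.mul_right _)
  have hgZ : g ∣ X 2 := by
    simpa [pderiv_X, Pi.single_apply] using dvd_pderiv_of_dvd hr0 hr hgr hg
  have hgT : g ∣ X 3 ^ 2 := (dvd_add_left (hgZ.mul_right _)).1 hg
  have := dvd_pderiv_of_dvd (i := 2) (pow_ne_zero 2 (X_ne_zero 3))
    (pow_mem (X_mem_supported.2 (by decide)) 2) hgT hgZ
  rw [pderiv_X_self] at this
  exact isUnit_of_dvd_one this

theorem isBlowDown_E7 : IsBlowDown potentialE7 polyE7 (glueMap compatible_E7) := by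
  refine isBlowDown_glueMap compatible_E7 (i := 0) (B := 0) (D := -branchE7)
    (c := X 3 ^ 2 + X 2 * X 1) (e := branchE7) ?_ (zero_mem _) (neg_mem branchE7_mem_supported) ?_
    eval_polyE7_gammaE7 eval_polyE7_betaE7 (fun q => exists_preimage_E7)
    boundsCoordinates_gammaE7 boundsCoordinates_betaE7 gammaE7_eq_zero_iff betaE7_eq_zero_iff
    ?_ branchE7_mem_supported isRelPrime_E7 ?_ ?_ invertibleAway_gammaE7
    (invertibleAway_betaE7.of_eq_sq fun m => ?_) ?_
  · rw [polyE7, branchE7]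
    ring
  · intro h
    have := congrArg (eval ![0, 1, 0, 0]) h
    simp [branchE7] at this
  · exact add_mem (pow_mem (X_mem_supported.2 (by decide)) 2)
      (mul_mem (X_mem_supported.2 (by decide)) (X_mem_supported.2 (by decide)))
  · refine ⟨![0, 0, 1], ?_⟩
    rw [eval_gammaE7]
    simp
  · refine ⟨![1, 0, 1], ?_⟩
    rw [eval_betaE7]
    simp
  · have h : eval (glueMap compatible_E7 m) polyE7 = 0 := by
      rcases exists_chart m with ⟨x, rfl⟩ | ⟨x, rfl⟩
      exacts [eval_polyE7_gammaE7 x, eval_polyE7_betaE7 x]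
    rw [eval_polyE7] at h
    simp only [branchE7, map_sub, map_mul, map_pow, map_ofNat, eval_X]
    linear_combination -h
  · rintro q ⟨hq, hq'⟩
    by_cases h0 : q 0 = 0
    · refine ⟨_, fun hd => hq' ?_, Or.inl invertibleAway_gammaE7⟩
      rw [singularLocus_E7]
      exact exists_eq_curve_E7 hq h0 (by simpa using hd)
    · exact ⟨X 0, by simpa using h0, Or.inr invertibleAway_betaE7⟩

end TypeE7

end Ferrari

theorem theorem2 :
    -- type A_k
    (∀ k : ℕ, 1 ≤ k →
      (∀ x y : ℂ, Ferrari.superpotential (Ferrari.potentialA k) x y =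
        1 / (k + 1) * x ^ (k + 1) + 1 / 2 * y ^ 2) ∧
      (∀ γ w : ℂ, γ ≠ 0 →
        HasDerivAt (Ferrari.potentialA k γ) (γ ^ 2 * w ^ k + w) w) ∧
      (∃ π, Ferrari.IsBlowDown (Ferrari.potentialA k) (Ferrari.polyA k) π) ∧
      Ferrari.singularLocus (Ferrari.polyA k) = {0}) ∧
    -- type D_{k+2}
    (∀ k : ℕ, 1 ≤ k →
      (∀ x y : ℂ, Ferrari.superpotential (Ferrari.potentialD k) x y =
        1 / (k + 1) * x ^ (k + 1) + x * y ^ 2) ∧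
      (∀ γ w : ℂ, γ ≠ 0 →
        HasDerivAt (Ferrari.potentialD k γ) (γ ^ 2 * w ^ k + w ^ 2) w) ∧
      (Even k →
        (∃ π, Ferrari.IsBlowDown (Ferrari.potentialD k) (Ferrari.polyDEven k) π) ∧
        Ferrari.singularLocus (Ferrari.polyDEven k) =
          {q | q 0 = 0 ∧ q 1 = 0 ∧ q 3 = q 2 ^ (k / 2)}) ∧
      (Odd k →
        (∃ π, Ferrari.IsBlowDown (Ferrari.potentialD k) (Ferrari.polyDOdd k) π) ∧
        Ferrari.singularLocus (Ferrari.polyDOdd k) = {0})) ∧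
    -- type E_7
    ((∀ x y : ℂ, Ferrari.superpotential Ferrari.potentialE7 x y =
        1 / 3 * y ^ 3 + y * x ^ 3) ∧
      (∀ γ w : ℂ, γ ≠ 0 →
        HasDerivAt (Ferrari.potentialE7 γ) (γ⁻¹ * w ^ 2 + γ * w ^ 3) w) ∧
      (∃ π, Ferrari.IsBlowDown Ferrari.potentialE7 Ferrari.polyE7 π) ∧
      Ferrari.singularLocus Ferrari.polyE7 =
        {q | ∃ t : ℂ, q = ![0, -t ^ 5, t ^ 3, t ^ 4]}) := by
  refine ⟨fun k hk => ⟨Ferrari.superpotential_A k, fun γ w _ => Ferrari.hasDerivAt_A k γ w,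
    ⟨_, Ferrari.isBlowDown_A hk⟩, Ferrari.singularLocus_A hk⟩,
    fun k hk => ⟨Ferrari.superpotential_D k, fun γ w _ => Ferrari.hasDerivAt_D k γ w, ?_, ?_⟩,
    Ferrari.superpotential_E7, fun γ w _ => Ferrari.hasDerivAt_E7 γ w,
    ⟨_, Ferrari.isBlowDown_E7⟩, Ferrari.singularLocus_E7⟩
  · intro hk'
    obtain ⟨h, rfl⟩ := even_iff_exists_two_mul.1 hk'
    have hh : 1 ≤ h := by omega
    rw [Nat.mul_div_cancel_left h two_pos]
    exact ⟨⟨_, Ferrari.isBlowDown_DEven hh⟩, Ferrari.singularLocus_DEven hh⟩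
  · rintro ⟨h, rfl⟩
    exact ⟨⟨_, Ferrari.isBlowDown_DOdd⟩, Ferrari.singularLocus_DOdd⟩
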